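/- **Setting.** Consider a classical field theory in one space dimension (the circle $S^1$ of length $2\pi$, or the line $\mathbb{R}$) with phase space $M$. Its local observables form a commutative algebra $\mathcal V$ of functions $f(x)$ of the field configuration and of the position $x$, smooth in $x$ (and periodic on the circle), stable under $\partial_x$, with a local Poisson bracket $$\{f(x),g(y)\}=\sum_{k\ge 0}c_k(x)\,\partial_x^k\delta_{xy}\qquad(\text{finite sum},\ c_k\in\mathcal V)$$ that is bilinear, skew-symmetric, compatible with $\partial_x$, and satisfies the Leibniz and Jacobi identities. $\mathcal V$ carries a topology for which the values $f(x)$ and the bracket (in each argument) are continuous. The bracket of two charges $\int dx\,f(x)$ and $\int dy\,g(y)$ is $\iint dx\,dy\,\{f(x),g(y)\}$. Let $\mathfrak g$ be $\mathfrak{sl}(d,\mathbb C)$ with $d\ge 2$ (type A), $\mathfrak{so}(N,\mathbb C)$ (types B, D) or $\mathfrak{sp}(2N,\mathbb C)$ (type C), in its defining matrix representation. Let $\sigma$ be an automorphism of $\mathfrak g$ of finite order $T$, $\omega$ a primitive $T$-th root of unity, and $C_{12}=\sum_a T^a\otimes T_a$, where $(T^a)$, $(T_a)$ are bases of $\mathfrak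 g$ with $\mathrm{Tr}(T^aT_b)=\delta^a_b$. Let $\varphi\neq 0$ be a rational function (the twist function) and put $$\mathcal R_{12}(\lambda,\mu)=\frac{\varphi(\mu)^{-1}}{T}\sum_{k=0}^{T-1}\frac{\sigma^k_{1}C_{12}}{\mu-\omega^{-k}\lambda}.$$ An $r/s$-system with twist function is given by a $\mathfrak g$-valued Lax matrix $\mathcal L(\lambda,x)$ with entries in $\mathcal V$ such that $\sigma(\mathcal L(\lambda,x))=\mathcal L(\omega\lambda,x)$ and $$\{\mathcal L_1(\lambda,x),\mathcal L_2(\mu,y)\}=[\mathcal R_{12}(\lambda,\mu),\mathcal L_1(\lambda,x)]\delta_{xy}-[\mathcal R_{21}(\mu,\lambda),\mathcal L_2(\mu,y)]\delta_{xy}-(\mathcal R_{12}(\lambda,\mu)+\mathcal R_{21}(\mu,\lambda))\,\partial_x\delta_{xy}.$$ A point $\lambda_0\in\mathbb C$ is a *regular zero* if $\varphi(\lambda_0)=0$ and $\varphi(\lambda)\mathcal L(\lambda,x)$ is regular at $\lambda_0$, i.e. converges in $\mathcal V$ as $\lambda\to\lambda_0$; let $J(x)$ be its value there. The point $\lambda_0=\infty$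 is a regular zero if $\psi(\alpha)=-\alpha^{-2}\varphi(1/\alpha)$ vanishes at $\alpha=0$ and $P(\alpha,x)=\alpha^{-1}\varphi(1/\alpha)\mathcal L(1/\alpha,x)$ is regular at $\alpha=0$, in the sense that $P(\alpha,x)$ and $(P(\alpha,x)-P(0,x))/\alpha$ have limits in $\mathcal V$ as $\alpha\to0$; then $J(x)$ is the value at $\alpha=0$ of $\psi(\alpha)\mathcal L^\infty(\alpha,x)=-(P(\alpha,x)-P(0,x))/\alpha$, where $\mathcal L^\infty(\alpha,x)=\mathcal L(1/\alpha,x)-\alpha\varphi(1/\alpha)^{-1}P(0,x)$. If $T=1$ every point is *non-cyclotomic*; if $T>1$ every point other than $0$ and $\infty$ is. **Local charges.** In types B, C, D let $\mathcal K_n^{\lambda_0}=\mathrm{Tr}(J^n)$ and let $\mathcal E_{\lambda_0}$ be the set of even integers $n\ge2$. In type A let $\mathcal K^{\lambda_0}_n$ be the coefficient of $\mu^n$ in the formal power series $\det(1-\mu J)^{(n-1)/d}$ and let $\mathcal E_{\lambda_0}$ be the set of integers $n\ge 2$ such that $d\nmid n-1$. Put $\mathcal Q^{\lambda_0}_n=\int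 dx\,\mathcal K^{\lambda_0}_n(x)$. **Theorem.** Let $\lambda_0$ be a non-cyclotomic regular zero of an $r/s$-system with twist function over $\mathfrak g$ as above. If the space is $\mathbb R$, assume that the entries of $J$ decrease at infinity (it is enough that they and their $x$-derivatives are integrable). Then for all $n,m\in\mathcal E_{\lambda_0}$ the integrals defining $\mathcal Q^{\lambda_0}_n$, $\mathcal Q^{\lambda_0}_m$ and their bracket converge, and $$\{\mathcal Q^{\lambda_0}_n,\mathcal Q^{\lambda_0}_m\}=0.$$ -/

import Mathlib

open MeasureTheory Filter Topology Polynomial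
open scoped Kronecker

noncomputable section

/-- The space on which the spatial coordinate lives: the circle (of length `2π`) or the line. -/
inductive Space
  | circle
  | line

/-- Lebesgue measure on a fundamental domain of the circle, or on the whole line. -/
def Space.measure : Space → Measure ℝ
  | .circle => volume.restrict (Set.Ioc 0 (2 * Real.pi))
  | .line => volume

/-- A classical field theory in one space dimension with phase space `M` and a local Poisson
bracket.

A local observable `f(x)` is a function of the field configuration `p : M` and of the position
`x`. The local observables in use form an algebra `obs`, stable under `∂_x`. The Poisson bracket of
two of them is a distribution supported on the diagonal,
`{f(x), g(y)} = ∑ k, c_k(x) ∂_x^k δ(x - y)`,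
and is recorded as the polynomial `br f g = ∑ k, c_k X^k` with coefficients in `obs`. -/
structure FieldTheory (M : Type*) where
  space : Space
  obs : Subalgebra ℂ (M → ℝ → ℂ)
  smooth : ∀ f : obs, ∀ p, ContDiff ℝ (⊤ : ℕ∞) (f.1 p)
  /-- On the circle every observable is periodic in the space coordinate. -/
  periodic : space = .circle → ∀ f : obs, ∀ p, Function.Periodic (f.1 p) (2 * Real.pi)
  /-- The space derivative of observables. -/
  dx : obs → obs
  dx_apply : ∀ (f : obs) (p : M) (x : ℝ), (dx f).1 p x = deriv (f.1 p) x
  /-- The Poisson bracket. -/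
  br : obs →ₗ[ℂ] obs →ₗ[ℂ] obs[X]
  /-- Leibniz rule `{f(x)g(x), h(y)} = f(x){g(x), h(y)} + g(x){f(x), h(y)}`. -/
  leibniz : ∀ f g h : obs, br (f * g) h = Polynomial.C f * br g h + Polynomial.C g * br f h
  /-- `{∂_x f(x), g(y)} = ∂_x {f(x), g(y)}`. -/
  br_dx : ∀ (f g : obs) (k : ℕ),
    (br (dx f) g).coeff k = dx ((br f g).coeff k) + (X * br f g).coeff k
  /-- Skew-symmetry: `{g(x), f(y)} = -{f(y), g(x)} = -∑ k, (-∂_x)^k (c_k(x) δ(x - y))`. -/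
  skew : ∀ (f g : obs) (j : ℕ),
    (br g f).coeff j =
      -((br f g).sum fun k c => ((-1 : ℤ) ^ k * (k.choose j : ℤ)) • dx^[k - j] c)
  /-- The Jacobi identity
  `{{f(x), g(y)}, h(z)} - {{f(x), h(z)}, g(y)} = {f(x), {g(y), h(z)}}`,
  written out as the equality of the coefficients of `∂_x^i δ(x - y) ∂_x^j δ(x - z)`. -/
  jacobi : ∀ (f g h : obs) (i j : ℕ),
    (br ((br f g).coeff i) h).coeff j - (br ((br f h).coeff j) g).coeff i =
      ∑ l ∈ Finset.range (j + 1),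
        (i + j - l).choose i • (br f ((br g h).coeff l)).coeff (i + j - l)
  /-- A topology on observables, used for limits of families of observables that depend on a
  parameter. The values of observables and the Poisson bracket (in each argument) are continuous.
  For example, the finest locally convex topology qualifies, since all linear maps are continuous
  for it; a family in a finite-dimensional space of observables converges in it as soon as its
  coordinates converge. -/
  top : TopologicalSpace obs
  continuous_apply : ∀ (p : M) (x : ℝ), Continuous fun f : obs => f.1 p x
  continuous_br_left : ∀ (g : obs) (k : ℕ), Continuous fun f : obs => (br f g).coeff k
  continuous_br_right : ∀ (f : obs) (k : ℕ), Continuous fun g : obs => (br f g).coeff k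

attribute [instance] FieldTheory.top

namespace FieldTheory

variable {M : Type*} (F : FieldTheory M)

/-- The value at the configuration `p` and the point `x` of `a(x) ∫ dy {f(x), g(y)} b(y)`, for test
functions `a` and `b`. -/
def smearedDensity (f g : F.obs) (a b : ℝ → ℂ) (p : M) (x : ℝ) : ℂ :=
  a x * (F.br f g).sum fun k c => c.1 p x * iteratedDeriv k b x

/-- The density in `x` of the Poisson bracket of the charges `∫ dx f(x)` and `∫ dy g(y)`. -/
def chargeBracketDensity (f g : F.obs) : M → ℝ → ℂ :=
  F.smearedDensity f g (fun _ => 1) (fun _ => 1)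

/-- The Poisson bracket of the charges `∫ dx f(x)` and `∫ dy g(y)`: the function
`∫∫ dx dy {f(x), g(y)}` on the phase space. -/
def chargeBracket (f g : F.obs) : M → ℂ := fun p =>
  ∫ x, F.chargeBracketDensity f g p x ∂F.space.measure

/-- The charge `∫ dx f(x)` with density `f`, as a function on the phase space, converges. -/
def HasCharge (f : F.obs) : Prop :=
  ∀ p, Integrable (f.1 p) F.space.measure

/-- The boundary condition on a field: on the line it decreases at infinity, in the weak sense that
it and its derivative are integrable. On the circle there is nothing to ask beyond periodicity. -/
def Decreases (f : F.obs) : Prop :=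
  F.space = .line → ∀ p, Integrable (f.1 p) ∧ Integrable (deriv (f.1 p))

end FieldTheory

attribute [local instance] LieRing.ofAssociativeRing

variable {ι : Type*} [Fintype ι] [DecidableEq ι]

/-- The data of an `r/s`-system with twist function over the matrix Lie algebra `𝔤`, in the field
theory `F`: a finite order automorphism, a twist function and an equivariant Lax matrix. -/
structure LaxData {M : Type*} (F : FieldTheory M) (𝔤 : LieSubalgebra ℂ (Matrix ι ι ℂ)) where
  /-- The order of the automorphism `σ`. -/
  T : ℕ
  T_pos : 0 < T
  σ : 𝔤 ≃ₗ⁅ℂ⁆ 𝔤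
  orderOf_σ : orderOf σ.toLinearEquiv = T
  /-- A primitive root of unity of order `T`. -/
  ω : ℂ
  ω_prim : IsPrimitiveRoot ω T
  /-- Index set of a basis of `𝔤`. -/
  κ : Type
  [fintypeκ : Fintype κ]
  [decEqκ : DecidableEq κ]
  basis : Module.Basis κ ℂ 𝔤
  /-- The basis dual to `basis` for the trace form. -/
  dual : κ → 𝔤
  trace_basis_dual : ∀ a b,
    Matrix.trace ((basis a : Matrix ι ι ℂ) * (dual b : Matrix ι ι ℂ)) = if a = b then 1 else 0
  /-- The twist function. -/
  φ : RatFunc ℂ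
  φ_ne_zero : φ ≠ 0
  /-- The values of the spectral parameter at which the Lax matrix is defined. -/
  dom : Set ℂ
  dom_mul : ∀ z ∈ dom, ω * z ∈ dom
  /-- The Lax matrix `ℒ(z, x)`, as a function of the spectral parameter `z`, of the field
  configuration and of `x`; its values for `z ∉ dom` are irrelevant. -/
  lax : ℂ → M → ℝ → 𝔤
  lax_mem : ∀ z i j, (fun p x => (lax z p x : Matrix ι ι ℂ) i j) ∈ F.obs
  /-- Equivariance of the Lax matrix. -/
  lax_equivariant : ∀ z ∈ dom, ∀ p x, σ (lax z p x) = lax (ω * z) p x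

attribute [instance] LaxData.fintypeκ LaxData.decEqκ

namespace LaxData

variable {M : Type*} {F : FieldTheory M} {𝔤 : LieSubalgebra ℂ (Matrix ι ι ℂ)} (S : LaxData F 𝔤)

/-- The value of the twist function at a point (only used where it is not a pole). -/
def twist (z : ℂ) : ℂ := S.φ.eval (RingHom.id ℂ) z

/-- The Lax matrix as a matrix of observables. -/
def L (z : ℂ) : Matrix ι ι F.obs := fun i j => ⟨_, S.lax_mem z i j⟩

/-- `σᵏ₁ C₁₂` for the Casimir tensor `C₁₂ = ∑ a, basis a ⊗ dual a`. The entry of `A ⊗ B` with index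
`((i, k), (j, l))` is `A i j * B k l`. -/
def casimir (k : ℕ) : Matrix (ι × ι) (ι × ι) ℂ :=
  ∑ a : S.κ, (S.σ^[k] (S.basis a) : Matrix ι ι ℂ) ⊗ₖ (S.dual a : Matrix ι ι ℂ)

/-- `R⁰₁₂(z, w) = T⁻¹ ∑_{k < T} σᵏ₁ C₁₂ / (w - ω⁻ᵏ z)`. -/
def R0 (z w : ℂ) : Matrix (ι × ι) (ι × ι) ℂ :=
  (S.T : ℂ)⁻¹ • ∑ k ∈ Finset.range S.T, (w - (S.ω ^ k)⁻¹ * z)⁻¹ • S.casimir k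

/-- `R₁₂(z, w) = R⁰₁₂(z, w) φ(w)⁻¹`. -/
def R₁₂ (z w : ℂ) : Matrix (ι × ι) (ι × ι) ℂ := (S.twist w)⁻¹ • S.R0 z w

/-- `R₂₁(z, w)`, which is `R₁₂(z, w)` with its two tensor factors exchanged. -/
def R₂₁ (z w : ℂ) : Matrix (ι × ι) (ι × ι) ℂ := (S.R₁₂ z w).submatrix Prod.swap Prod.swap

/-- The coefficient `[R₁₂(z, w), ℒ₁(z, x)] - [R₂₁(w, z), ℒ₂(w, x)]` of `δ_xy` in the Maillet
bracket. -/
def mailletDelta (z w : ℂ) : Matrix (ι × ι) (ι × ι) F.obs :=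
  let r : Matrix (ι × ι) (ι × ι) F.obs := (S.R₁₂ z w).map (algebraMap ℂ F.obs)
  let r' : Matrix (ι × ι) (ι × ι) F.obs := (S.R₂₁ w z).map (algebraMap ℂ F.obs)
  let L₁ : Matrix (ι × ι) (ι × ι) F.obs := S.L z ⊗ₖ (1 : Matrix ι ι F.obs)
  let L₂ : Matrix (ι × ι) (ι × ι) F.obs := (1 : Matrix ι ι F.obs) ⊗ₖ S.L w
  (r * L₁ - L₁ * r) - (r' * L₂ - L₂ * r')

/-- The coefficient `-(R₁₂(z, w) + R₂₁(w, z))` of `δ'_xy = ∂_x δ_xy` in the Maillet bracket. -/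
def mailletDelta' (z w : ℂ) : Matrix (ι × ι) (ι × ι) F.obs :=
  (-(S.R₁₂ z w + S.R₂₁ w z)).map (algebraMap ℂ F.obs)

end LaxData

/-- An `r/s`-system with twist function: the Poisson bracket of the Lax matrix with itself is
`{ℒ₁(z,x), ℒ₂(w,y)} = ([R₁₂(z,w), ℒ₁(z,x)] - [R₂₁(w,z), ℒ₂(w,y)]) δ_xy
  - (R₁₂(z,w) + R₂₁(w,z)) δ'_xy`
wherever the right hand side is defined. -/
structure RSSystem {M : Type*} (F : FieldTheory M) (𝔤 : LieSubalgebra ℂ (Matrix ι ι ℂ))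
    extends LaxData F 𝔤 where
  maillet : ∀ z ∈ dom, ∀ w ∈ dom, toLaxData.twist z ≠ 0 → toLaxData.twist w ≠ 0 →
    z ^ T ≠ w ^ T → ∀ i j k l,
      F.br (toLaxData.L z i j) (toLaxData.L w k l) =
        Polynomial.C (toLaxData.mailletDelta z w (i, k) (j, l)) +
          Polynomial.C (toLaxData.mailletDelta' z w (i, k) (j, l)) * X

namespace RSSystem

variable {M : Type*} {F : FieldTheory M} {𝔤 : LieSubalgebra ℂ (Matrix ι ι ℂ)} (S : RSSystem F 𝔤)

/-- `z` is a regular zero of the twist function `φ`: `φ(z) = 0` and `φ(w) ℒ(w, x)` is regular at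
`w = z`, with value `J(x)` there. -/
def IsFiniteRegularZero (z : ℂ) (J : Matrix ι ι F.obs) : Prop :=
  S.φ.num.eval z = 0 ∧ (∀ᶠ w in 𝓝[≠] z, w ∈ S.dom) ∧
    ∀ i j, Tendsto (fun w => S.twist w • S.L w i j) (𝓝[≠] z) (𝓝 (J i j))

/-- The twist function `ψ(α) = -α⁻² φ(1/α)` in the coordinate `α = 1/z` at infinity. -/
def twistInfty (α : ℂ) : ℂ := -(α⁻¹) ^ 2 * S.twist α⁻¹

/-- The Lax matrix `ℒ^∞(α, x) = ℒ(1/α, x) - α φ(1/α)⁻¹ 𝒞(x)` at infinity, for a field `𝒞`. -/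
def LInfty (Cfield : Matrix ι ι F.obs) (α : ℂ) : Matrix ι ι F.obs :=
  S.L α⁻¹ - (α * (S.twist α⁻¹)⁻¹) • Cfield

/-- Infinity is a regular zero: `ψ(0) = 0` and `P(α, x) = α⁻¹ φ(1/α) ℒ(1/α, x)` is regular at
`α = 0`. With `𝒞(x) = P(0, x)` one has `ψ(α) ℒ^∞(α, x) = -(P(α, x) - P(0, x)) / α`, so that this is
regular at `α = 0` as well; its value there is `J(x)`. -/
def IsRegularZeroInfty (J : Matrix ι ι F.obs) : Prop :=
  Tendsto S.twistInfty (𝓝[≠] 0) (𝓝 0) ∧ (∀ᶠ α in 𝓝[≠] (0 : ℂ), α⁻¹ ∈ S.dom) ∧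
    ∃ Cfield : Matrix ι ι F.obs,
      (∀ i j, Tendsto (fun α => (α⁻¹ * S.twist α⁻¹) • S.L α⁻¹ i j) (𝓝[≠] 0)
        (𝓝 (Cfield i j))) ∧
      ∀ i j, Tendsto (fun α => S.twistInfty α • S.LInfty Cfield α i j) (𝓝[≠] 0) (𝓝 (J i j))

/-- `z₀` is a regular zero, and `J(x)` is the value there of the product of the twist function with
the Lax matrix. -/
def IsRegularZero : OnePoint ℂ → Matrix ι ι F.obs → Prop
  | OnePoint.some z, J => S.IsFiniteRegularZero z J
  | OnePoint.infty, J => S.IsRegularZeroInfty J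

/-- For `T = 1` every point is non-cyclotomic, for `T > 1` every point but `0` and `∞`. -/
def NonCyclotomic (z₀ : OnePoint ℂ) : Prop :=
  S.T = 1 ∨ (z₀ ≠ ((0 : ℂ) : OnePoint ℂ) ∧ z₀ ≠ OnePoint.infty)

end RSSystem

/-- The classical families of complex Lie algebras in their defining representations. -/
inductive ClassicalType
  /-- `𝔰𝔩(d)` with `d ≥ 2` -/
  | A (d : ℕ) (hd : 2 ≤ d)
  /-- `𝔰𝔬(N)` -/
  | BD (N : ℕ)
  /-- `𝔰𝔭(2N)` -/
  | C (N : ℕ)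

namespace ClassicalType

/-- The index type of the matrices. -/
abbrev Idx : ClassicalType → Type
  | A d _ => Fin d
  | BD N => Fin N
  | C N => Fin N ⊕ Fin N

instance : (t : ClassicalType) → Fintype t.Idx
  | A d _ => inferInstanceAs (Fintype (Fin d))
  | BD N => inferInstanceAs (Fintype (Fin N))
  | C N => inferInstanceAs (Fintype (Fin N ⊕ Fin N))

instance : (t : ClassicalType) → DecidableEq t.Idx
  | A d _ => inferInstanceAs (DecidableEq (Fin d))
  | BD N => inferInstanceAs (DecidableEq (Fin N))
  | C N => inferInstanceAs (DecidableEq (Fin N ⊕ Fin N))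

/-- The Lie algebra. -/
def alg : (t : ClassicalType) → LieSubalgebra ℂ (Matrix t.Idx t.Idx ℂ)
  | A d _ => LieAlgebra.SpecialLinear.sl (Fin d) ℂ
  | BD N => LieAlgebra.Orthogonal.so (Fin N) ℂ
  | C N => LieAlgebra.Symplectic.sp (Fin N) ℂ

/-- The degrees of the local charges. In type A these are the exponents of the affine algebra plus
one. -/
def degrees : ClassicalType → Set ℕ
  | A d _ => {n | 2 ≤ n ∧ ¬ d ∣ n - 1}
  | BD _ => {n | 2 ≤ n ∧ Even n}
  | C _ => {n | 2 ≤ n ∧ Even n}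

/-- The `r`-th power of a formal power series with constant coefficient `1`, given by the binomial
series. -/
def seriesPow {A : Type*} [CommRing A] [Algebra ℂ A] (f : PowerSeries A) (r : ℂ) : PowerSeries A :=
  (PowerSeries.binomialSeries A r).subst (f - 1)

/-- The density of the local charge of degree `n`, as a polynomial in the entries of the matrix `J`:
the coefficient of `μ^n` in `det(1 - μ J)^((n - 1) / d)` for `𝔰𝔩(d)`, and `Tr(J^n)` otherwise. -/
def density {A : Type*} [CommRing A] [Algebra ℂ A] :
    (t : ClassicalType) → Matrix t.Idx t.Idx A → ℕ → A
  | .A d _, J, n =>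
      PowerSeries.coeff n
        (seriesPow (1 - (PowerSeries.X : PowerSeries A) • J.map (PowerSeries.C (R := A))).det
          (((n : ℂ) - 1) / (d : ℂ)))
  | .BD _, J, n => (J ^ n).trace
  | .C _, J, n => (J ^ n).trace

end ClassicalType

end

set_option linter.unusedSectionVars false

/-! The residual field `J` at a regular zero behaves like a Kac-Moody current. Multiplying the
Maillet bracket by `φ(z) φ(w)` cancels the factors `φ⁻¹` in `R`, and letting first `z` and then `w`
tend to the zero leaves a bracket of `J` with itself whose `δ'` coefficient is a constant multiple
`c C₂₁` of the Casimir tensor. Its `δ` coefficient need not be computed. It only has to vanish when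
paired with `U ⊗ V`, where `U` and `V` commute with `J` and with each other and `U` takes values in
`𝔤`. This is `LaxData.IsCurrent`, proved at finite points by `IsFiniteRegularZero.isCurrent` and at
infinity by `IsRegularZeroInfty.isCurrent`.

The densities of degrees `n` and `m` have such gradients `U` and `V`: they are polynomials in `J`,
and `U ∈ 𝔤` by `gradient_map_mem_alg`. The bracket of the two charges therefore has density `c Tr(U
∂V)` (`IsCurrent.exists_br_coeff_zero`). It remains to see that this is a total derivative, which
follows from the integrability relation `(n-1) Tr(U ∂V) = (m-1) Tr(V ∂U)`
(`gradient_integrability`): adding the two traces gives `Tr(U ∂V) = (m-1)/(n+m-2) ∂ Tr(UV)`.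

For traces of powers the relation is immediate. In type A put `G = (1 - μJ)⁻¹` and `w = det(1 -
μJ)^ρ` with `ρ = (n-1)/d`; the gradient is `-ρ [μⁿ⁻¹] wG`. The exponent is chosen so that `[μⁿ⁻¹]
μw(G² - ρ Tr(G) G) = 0` (`IsDetPow.map_coeff_eq_zero`). The resolvent identity, with separate
variables `μ`, `ν` for the two gradients, rewrites the defect in the integrability relation in terms
of such vanishing coefficients (`trace_resolvent_identity`). -/

noncomputable section

/-! ### Derivations acting entrywise on matrices and coefficientwise on power series -/

namespace Derivation

variable {R A ι : Type*} [CommRing R] [CommRing A] [Algebra R A] [Fintype ι] [DecidableEq ι]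
  (D : Derivation R A A)

theorem matrix_map_mul (M N : Matrix ι ι A) : (M * N).map D = M.map D * N + M * N.map D := by
  ext i j
  simp only [Matrix.map_apply, Matrix.mul_apply, Matrix.add_apply, map_sum, leibniz, smul_eq_mul,
    ← Finset.sum_add_distrib]
  exact Finset.sum_congr rfl fun k _ => by ring

theorem matrix_map_smul (a : A) (M : Matrix ι ι A) : (a • M).map D = D a • M + a • M.map D := by
  ext i j; simp [mul_comm, add_comm]

theorem matrix_map_one : (1 : Matrix ι ι A).map D = 0 := by
  ext i j; by_cases h : i = j <;> simp [h]

theorem trace_matrix_map (M : Matrix ι ι A) : (M.map D).trace = D M.trace := by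
  simp [Matrix.trace]

/-- If `Y` commutes with `M`, then `Tr (Y D(Mⁿ)) = n Tr (Y Mⁿ⁻¹ D M)`. -/
theorem trace_mul_map_pow {M Y : Matrix ι ι A} (h : Commute Y M) (n : ℕ) :
    (Y * (M ^ n).map D).trace = n • (Y * M ^ (n - 1) * M.map D).trace := by
  induction n generalizing Y with
  | zero => simp [matrix_map_one]
  | succ n ih =>
    have h2 := ih (h.mul_left (Commute.refl M))
    have e1 : (Y * ((M ^ n).map D * M)).trace = (Y * M * (M ^ n).map D).trace := by
      rw [← mul_assoc, Matrix.trace_mul_comm, ← mul_assoc, h.eq]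
    rw [pow_succ, matrix_map_mul, mul_add, Matrix.trace_add, e1, h2]
    rcases n with _ | n
    · simp
    · have : Y * M * M ^ (n + 1 - 1) = Y * M ^ (n + 1) := by
        rw [mul_assoc, Nat.add_sub_cancel, pow_succ']
      rw [this, Nat.add_sub_cancel, add_smul (n + 1) 1, one_smul, mul_assoc Y]

theorem leibniz_prod' {κ : Type*} [DecidableEq κ] (s : Finset κ) (f : κ → A) :
    D (∏ i ∈ s, f i) = ∑ i ∈ s, (∏ j ∈ s.erase i, f j) * D (f i) := by
  induction s using Finset.induction_on with
  | empty => simp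
  | insert a s ha ih =>
    rw [Finset.prod_insert ha, leibniz, ih, Finset.sum_insert ha, Finset.erase_insert ha,
      smul_eq_mul, smul_eq_mul, Finset.mul_sum, add_comm]
    congr 1
    refine Finset.sum_congr rfl fun i hi => ?_
    have hia : a ≠ i := fun h => ha (h ▸ hi)
    rw [Finset.erase_insert_of_ne hia, Finset.prod_insert (fun h => ha (Finset.mem_of_mem_erase h)),
      mul_assoc]

/-- Jacobi's formula. -/
theorem map_det (M : Matrix ι ι A) : D M.det = (M.adjugate * M.map D).trace := by
  -- By Cramer's rule each diagonal entry is the determinant with one column differentiated, so the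
  -- trace is the Leibniz expansion by columns.
  have key : ∀ i, (M.adjugate * M.map D) i i = (M.updateCol i (fun j => D (M j i))).det := by
    intro i
    rw [← Matrix.cramer_apply, Matrix.cramer_eq_adjugate_mulVec]
    rfl
  simp only [Matrix.trace, Matrix.diag, key, Matrix.det_apply', map_sum]
  rw [Finset.sum_comm]
  refine Finset.sum_congr rfl fun s _ => ?_
  rw [leibniz, leibniz_prod', D.map_intCast, smul_zero, add_zero, smul_eq_mul, Finset.mul_sum]
  refine Finset.sum_congr rfl fun i _ => ?_
  rw [← Finset.mul_prod_erase _ _ (Finset.mem_univ i), Matrix.updateCol_self,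
    mul_comm (D _) (∏ _ ∈ _, _)]
  congr 2
  refine Finset.prod_congr rfl fun j hj => ?_
  rw [Matrix.updateCol_ne (Finset.ne_of_mem_erase hj)]

/-- The derivation of power series acting on coefficients. -/
def coeffwise : Derivation R (PowerSeries A) (PowerSeries A) :=
  Derivation.mk'
    { toFun := fun f => PowerSeries.mk fun n => D (PowerSeries.coeff n f)
      map_add' := fun f g => by ext n; simp
      map_smul' := fun r f => by ext n; simp }
    fun f g => by
      ext n
      simp only [LinearMap.coe_mk, AddHom.coe_mk, PowerSeries.coeff_mk, PowerSeries.coeff_mul,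
        map_sum, map_add, leibniz, smul_eq_mul, Finset.sum_add_distrib]
      congr 1
      rw [← Finset.Nat.sum_antidiagonal_swap]
      rfl

@[simp]
theorem coeff_coeffwise (f : PowerSeries A) (n : ℕ) :
    PowerSeries.coeff n (D.coeffwise f) = D (PowerSeries.coeff n f) := by
  simp [coeffwise]

@[simp]
theorem coeffwise_X : D.coeffwise (PowerSeries.X : PowerSeries A) = 0 := by
  ext n; by_cases h : n = 1 <;> simp [PowerSeries.coeff_X, h]

@[simp]
theorem coeffwise_C (a : A) : D.coeffwise (PowerSeries.C a) = PowerSeries.C (D a) := by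
  ext n; by_cases h : n = 0 <;> simp [PowerSeries.coeff_C, h]

end Derivation

/-! ### The resolvent `G = (1 - μJ)⁻¹` as a matrix of formal power series -/

namespace Matrix

variable {A ι : Type*} [CommRing A] [Fintype ι] [DecidableEq ι]

open PowerSeries

/-- The geometric series `(1 - X J)⁻¹ = ∑ i, Jⁱ Xⁱ`. -/
def geom (J : Matrix ι ι A) : Matrix ι ι (PowerSeries A) :=
  fun a b => PowerSeries.mk fun i => (J ^ i) a b

theorem geom_eq (J : Matrix ι ι A) :
    J.geom = 1 + (X : PowerSeries A) • (J.map (PowerSeries.C (R := A)) * J.geom) := by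
  ext a b n
  rcases n with _ | n
  · by_cases h : a = b <;> simp [geom, h]
  · by_cases h : a = b <;>
    simp [geom, pow_succ' J n, Matrix.mul_apply, PowerSeries.coeff_succ_X_mul,
      h, PowerSeries.coeff_one]

theorem geom_eq' (J : Matrix ι ι A) :
    J.geom = 1 + (X : PowerSeries A) • (J.geom * J.map (PowerSeries.C (R := A))) := by
  ext a b n
  rcases n with _ | n
  · by_cases h : a = b <;> simp [geom, h]
  · by_cases h : a = b <;>
    simp [geom, pow_succ J n, Matrix.mul_apply, PowerSeries.coeff_succ_X_mul,
      h, PowerSeries.coeff_one]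

theorem one_sub_mul_geom (J : Matrix ι ι A) :
    (1 - (X : PowerSeries A) • J.map (PowerSeries.C (R := A))) * J.geom = 1 := by
  conv_rhs => rw [← sub_eq_of_eq_add J.geom_eq]
  rw [sub_mul, one_mul, smul_mul_assoc]

theorem geom_mul_one_sub (J : Matrix ι ι A) :
    J.geom * (1 - (X : PowerSeries A) • J.map (PowerSeries.C (R := A))) = 1 := by
  conv_rhs => rw [← sub_eq_of_eq_add J.geom_eq']
  rw [mul_sub, mul_one, mul_smul_comm]

theorem X_mul_trace_geom_mul (J : Matrix ι ι A) :
    (X : PowerSeries A) * (J.geom * J.map (PowerSeries.C (R := A))).trace = J.geom.trace - (Fintype.card ι : ℕ) := by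
  conv_rhs => rw [geom_eq']
  simp [Matrix.trace_add, Matrix.trace_smul, Matrix.trace_one]

theorem geom_map_derivative (J : Matrix ι ι A) :
    J.geom.map (d⁄dX A) = J.geom * J.map (PowerSeries.C (R := A)) * J.geom := by
  have h := congrArg (fun M : Matrix ι ι (PowerSeries A) => M.map (d⁄dX A)) J.one_sub_mul_geom
  simp only [Derivation.matrix_map_mul, Derivation.matrix_map_one] at h
  have e : (1 - (X : PowerSeries A) • J.map (PowerSeries.C (R := A))).map (d⁄dX A)
      = - J.map (PowerSeries.C (R := A)) := by
    ext a b
    by_cases h : a = b <;> simp [h, Derivation.leibniz]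
  rw [e] at h
  have h2 := congrArg (fun M => J.geom * M) h
  simp only [mul_add, mul_zero, ← mul_assoc, J.geom_mul_one_sub, one_mul] at h2
  rw [eq_neg_of_add_eq_zero_right h2]
  simp [mul_assoc]

/-- `(μG)' = G + μ G J G = (1 + μ G J) G = G²`. -/
theorem X_smul_geom_map_derivative (J : Matrix ι ι A) :
    ((X : PowerSeries A) • J.geom).map (d⁄dX A) = J.geom * J.geom := by
  rw [Derivation.matrix_map_smul, geom_map_derivative]
  conv_rhs => rw [geom_eq', add_mul, ← geom_eq', one_mul, smul_mul_assoc]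
  simp

theorem geom_map_coeffwise {R : Type*} [CommRing R] [Algebra R A] (D : Derivation R A A)
    (J : Matrix ι ι A) : J.geom.map D.coeffwise =
      (X : PowerSeries A) • (J.geom * (J.map D).map (PowerSeries.C (R := A)) * J.geom) := by
  have h := congrArg (fun M : Matrix ι ι (PowerSeries A) => M.map D.coeffwise) J.one_sub_mul_geom
  simp only [Derivation.matrix_map_mul, Derivation.matrix_map_one] at h
  have e : (1 - (X : PowerSeries A) • J.map (PowerSeries.C (R := A))).map D.coeffwise
      = - ((X : PowerSeries A) • (J.map D).map (PowerSeries.C (R := A))) := by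
    ext a b : 2
    by_cases h : a = b <;> simp [h, Derivation.leibniz]
  rw [e] at h
  have h2 := congrArg (fun M => J.geom * M) h
  simp only [mul_add, mul_zero, ← mul_assoc, J.geom_mul_one_sub, one_mul] at h2
  rw [eq_neg_of_add_eq_zero_right h2]
  simp [mul_assoc]

/-- Jacobi's formula, with the adjugate of `1 - μJ` expressed as its determinant times `G`. -/
theorem derivative_det_one_sub (J : Matrix ι ι A) :
    d⁄dX A (1 - (X : PowerSeries A) • J.map (PowerSeries.C (R := A))).det =
      -((1 - (X : PowerSeries A) • J.map (PowerSeries.C (R := A))).det *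
        (J.geom * J.map (PowerSeries.C (R := A))).trace) := by
  set N := 1 - (X : PowerSeries A) • J.map (PowerSeries.C (R := A)) with hN
  have e : N.map (d⁄dX A) = - J.map (PowerSeries.C (R := A)) := by
    ext a b
    by_cases h : a = b <;> simp [hN, h, Derivation.leibniz]
  have hadj : N.adjugate = N.det • J.geom := by
    calc N.adjugate = N.adjugate * (N * J.geom) := by rw [J.one_sub_mul_geom, mul_one]
      _ = _ := by rw [← mul_assoc, adjugate_mul, smul_mul_assoc, one_mul]
  rw [Derivation.map_det, e, hadj]
  simp

theorem constantCoeff_det_one_sub (J : Matrix ι ι A) : constantCoeff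
    (1 - (X : PowerSeries A) • J.map (PowerSeries.C (R := A))).det = 1 := by
  rw [RingHom.map_det, ← det_one (n := ι)]
  congr 1
  ext a b
  by_cases h : a = b <;> simp [Matrix.one_apply, h]

end Matrix

/-! ### Complex powers of series through their differential equation -/

namespace PowerSeries

variable {A : Type*} [CommRing A] [Algebra ℂ A]

/-- Coefficientwise this is the recursion `(n+1) (r choose n+1) = (r-n) (r choose n)`. -/
theorem one_add_X_mul_derivative_binomialSeries (r : ℂ) :
    (1 + X) * d⁄dX A (binomialSeries A r) = algebraMap ℂ A r • binomialSeries A r := by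
  have key : ∀ n : ℕ, Ring.choose r (n + 1) * (n + 1) = Ring.choose r n * (r - n) := by
    intro n
    have := Ring.choose_smul_choose r (Nat.le_succ n)
    simpa [Nat.choose_succ_self_right, mul_comm] using this
  ext n
  rw [add_mul, one_mul, map_add, coeff_derivative, coeff_smul]
  have h1 : (coeff n) (X * d⁄dX A (binomialSeries A r)) = n * algebraMap ℂ A (Ring.choose r n) := by
    rcases n with _ | n
    · simp
    · rw [coeff_succ_X_mul, coeff_derivative, binomialSeries_coeff, Algebra.smul_def]
      push_cast; ring
  have h2 := congrArg (algebraMap ℂ A) (key n)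
  rw [h1, binomialSeries_coeff, binomialSeries_coeff]
  simp only [Algebra.smul_def, mul_one, map_mul, map_add, map_sub, map_natCast, map_one] at h2 ⊢
  linear_combination h2

/-- Uniqueness for a linear equation: the coefficient of degree `n` of `y q` involves only
coefficients of `y` up to degree `n`, and `n + 1` is invertible over `ℂ`. -/
theorem eq_zero_of_derivative_eq_mul {y q : PowerSeries A} (h : d⁄dX A y = y * q)
    (h0 : constantCoeff y = 0) : y = 0 := by
  ext n
  induction n using Nat.strong_induction_on with
  | _ n ih =>
    rcases n with _ | n
    · simpa using h0
    · have h1 := congrArg (coeff n) h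
      rw [coeff_derivative, coeff_mul, Finset.sum_eq_zero] at h1
      · have h2 : (algebraMap ℂ A ((n : ℂ) + 1)⁻¹) * ((n : A) + 1) = 1 := by
          have : ((n : A) + 1) = algebraMap ℂ A ((n : ℂ) + 1) := by simp
          rw [this, ← map_mul, inv_mul_cancel₀ (Nat.cast_add_one_ne_zero n), map_one]
        calc coeff (n + 1) y = coeff (n + 1) y * ((n : A) + 1) *
              algebraMap ℂ A ((n : ℂ) + 1)⁻¹ := by
              rw [mul_assoc, mul_comm ((n : A) + 1), h2, mul_one]
          _ = _ := by rw [h1]; simp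
      · intro x hx
        rw [ih x.1 (Nat.lt_succ_of_le (by have := Finset.HasAntidiagonal.mem_antidiagonal.1 hx; omega))]
        simp

theorem derivative_coeffwise (D : Derivation ℂ A A) (f : PowerSeries A) :
    d⁄dX A (D.coeffwise f) = D.coeffwise (d⁄dX A f) := by
  ext n
  simp only [coeff_derivative, Derivation.coeff_coeffwise, Derivation.leibniz, smul_eq_mul]
  simp [mul_comm]

end PowerSeries

namespace ClassicalType

open PowerSeries

variable {A : Type*} [CommRing A] [Algebra ℂ A]

theorem constantCoeff_seriesPow {f : PowerSeries A} (hf : constantCoeff f = 1) (r : ℂ) :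
    constantCoeff (seriesPow f r) = 1 := by
  have hs : PowerSeries.constantCoeff (f - 1) = 0 := by simp [hf]
  have h0 := constantCoeff_subst_eq_zero hs (binomialSeries A r - 1) (by simp)
  have hsub : HasSubst (f - 1) := HasSubst.of_constantCoeff_zero hs
  rw [subst_sub hsub, ← coe_substAlgHom hsub, map_one, map_sub, sub_eq_zero, map_one] at h0
  rw [seriesPow, ← coe_substAlgHom hsub]
  exact h0

theorem mul_derivative_seriesPow {f : PowerSeries A} (hf : constantCoeff f = 1) (r : ℂ) :
    f * d⁄dX A (seriesPow f r) = algebraMap ℂ A r • (seriesPow f r * d⁄dX A f) := by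
  have hs : PowerSeries.constantCoeff (f - 1) = 0 := by simp [hf]
  have hsub : HasSubst (f - 1) := HasSubst.of_constantCoeff_zero hs
  have h := congrArg (substAlgHom (R := A) hsub) (one_add_X_mul_derivative_binomialSeries (A := A) r)
  rw [map_mul, map_add, map_one, map_smul, substAlgHom_X, coe_substAlgHom] at h
  rw [seriesPow, derivative_subst hsub, ← mul_assoc]
  rw [add_sub_cancel] at h
  rw [h]
  simp

end ClassicalType

/-! ### Powers of `det(1 - μJ)` and their differentials -/

namespace Matrix

open PowerSeries

variable {A ι : Type*} [CommRing A] [Fintype ι] [DecidableEq ι]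

/-- In `A⟦μ⟧⟦ν⟧` the inner variable is `μ`: `C` embeds series in `μ`, and `map C` embeds series in
the outer variable `ν`. Extracting coefficients therefore separates the two factors. -/
theorem coeff_coeff_trace_map_C_mul_map_map (M N : Matrix ι ι (PowerSeries A)) (k l : ℕ) :
    PowerSeries.coeff k (PowerSeries.coeff l
      (M.map (PowerSeries.C (R := PowerSeries A)) *
        N.map (PowerSeries.map (PowerSeries.C (R := A)))).trace) =
      (M.map (PowerSeries.coeff k) * N.map (PowerSeries.coeff l)).trace := by
  simp [Matrix.trace, Matrix.mul_apply, PowerSeries.coeff_C_mul, PowerSeries.coeff_mul_C]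

/-- `w` has the logarithmic derivative of the `ρ`-th power of `det (1 - X J)`. -/
def IsDetPow (J : Matrix ι ι A) (ρ : A) (w : PowerSeries A) : Prop :=
  d⁄dX A w = -(PowerSeries.C ρ * w * (J.geom * J.map (PowerSeries.C (R := A))).trace)

theorem isDetPow_seriesPow [Algebra ℂ A] (J : Matrix ι ι A) (r : ℂ) :
    J.IsDetPow (algebraMap ℂ A r) (ClassicalType.seriesPow
      (1 - (PowerSeries.X : PowerSeries A) • J.map (PowerSeries.C (R := A))).det r) := by
  set f := (1 - (PowerSeries.X : PowerSeries A) • J.map (PowerSeries.C (R := A))).det with hf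
  have hf1 : PowerSeries.constantCoeff f = 1 := J.constantCoeff_det_one_sub
  have hu : IsUnit f := PowerSeries.isUnit_iff_constantCoeff.2 (by rw [hf1]; exact isUnit_one)
  rw [IsDetPow]
  refine hu.mul_left_cancel ?_
  rw [ClassicalType.mul_derivative_seriesPow hf1, hf, derivative_det_one_sub, ← hf,
    PowerSeries.smul_eq_C_mul]
  ring

variable {J : Matrix ι ι A} {ρ σ : A} {w z : PowerSeries A}

/-- Expand `(μwG)'` using `(μG)' = G²` and the equation for `w'`, then eliminate `μ Tr(GJ) = Tr G -
d`, where `d` is the size of `J`. -/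
theorem IsDetPow.smul_geom_sub (hw : J.IsDetPow ρ w) :
    w • (J.geom * J.geom - (PowerSeries.C ρ * J.geom.trace) • J.geom) =
      ((PowerSeries.X * w) • J.geom).map (d⁄dX A) - (Fintype.card ι * PowerSeries.C ρ * w) • J.geom
      := by
  rw [mul_comm PowerSeries.X w, mul_smul w PowerSeries.X, Derivation.matrix_map_smul, X_smul_geom_map_derivative,
    hw, smul_sub, smul_smul, smul_smul, add_comm, add_sub_assoc, sub_eq_add_neg, ← neg_smul,
    ← sub_smul]
  congr 2
  linear_combination (PowerSeries.C ρ * w) * J.X_mul_trace_geom_mul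

/-- The `k`-th coefficient of `w μ (G² - ρ Tr(G) G)` vanishes if `k = ρ d`. -/
theorem IsDetPow.map_coeff_eq_zero (hw : J.IsDetPow ρ w) {k : ℕ}
    (hk : (k : A) = Fintype.card ι * ρ) :
    ((PowerSeries.X * w) • (J.geom * J.geom - (PowerSeries.C ρ * J.geom.trace) • J.geom)).map
      (PowerSeries.coeff k) = 0 := by
  rw [mul_smul, hw.smul_geom_sub]
  ext a b
  rcases k with _ | k
  · simp
  -- The derivative contributes `k` times, and the last term `dρ` times, the coefficient of `μᵏ⁻¹`
  -- in `wG`.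
  · simp only [map_apply, smul_apply, sub_apply, smul_eq_mul, PowerSeries.coeff_succ_X_mul, map_sub,
      PowerSeries.coeff_derivative, zero_apply]
    have : (Fintype.card ι : PowerSeries A) * PowerSeries.C ρ * w * J.geom a b =
      PowerSeries.C ((Fintype.card ι : A) * ρ) * (w * J.geom a b) := by simp [mul_assoc]
    rw [this, PowerSeries.coeff_C_mul, ← hk, mul_assoc, PowerSeries.coeff_succ_X_mul]
    push_cast; ring

/-- Since `ρ w Tr G = dρ w - μ w'`, the coefficient is `(dρ - k)` times that of `w`. This makes the
gradients in type A traceless. -/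
theorem IsDetPow.coeff_mul_trace_geom (hw : J.IsDetPow ρ w) {k : ℕ}
    (hk : (k : A) = Fintype.card ι * ρ) : PowerSeries.coeff k (PowerSeries.C ρ * w * J.geom.trace) = 0 := by
  have h : PowerSeries.C ρ * w * J.geom.trace =
      PowerSeries.C (Fintype.card ι * ρ) * w - PowerSeries.X * d⁄dX A w := by
    rw [hw, map_mul, map_natCast]
    linear_combination (-PowerSeries.C ρ * w) * J.X_mul_trace_geom_mul
  rw [h, ← hk, map_sub, PowerSeries.coeff_C_mul]
  rcases k with _ | k
  · simp
  · rw [PowerSeries.coeff_succ_X_mul, PowerSeries.coeff_derivative]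
    push_cast; ring

/-- With `p = Tr(GJ)`, both sides solve `y' = -ρ p y - ρ w D(p)` and have zero constant term, so
their difference vanishes by uniqueness. -/
theorem IsDetPow.coeffwise [Algebra ℂ A] (hw : J.IsDetPow ρ w)
    (hw1 : PowerSeries.constantCoeff w = 1) (D : Derivation ℂ A A) (hρ : D ρ = 0) :
    D.coeffwise w = -(PowerSeries.C ρ * PowerSeries.X * w *
      (J.geom * (J.map D).map (PowerSeries.C (R := A))).trace) := by
  set p := (J.geom * J.map (PowerSeries.C (R := A))).trace with hp
  set θ := (J.map D).map (PowerSeries.C (R := A)) with hθ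
  -- Apply `D` to `μ p = Tr G - d` and cancel `μ`.
  have hDp : D.coeffwise p = (J.geom * J.geom * θ).trace := by
    have h := congrArg D.coeffwise J.X_mul_trace_geom_mul
    rw [← hp, Derivation.leibniz, Derivation.coeffwise_X, smul_zero, add_zero, map_sub,
      Derivation.map_natCast, sub_zero, ← Derivation.trace_matrix_map _ J.geom,
      geom_map_coeffwise, trace_smul, smul_eq_mul, smul_eq_mul] at h
    rw [PowerSeries.X_mul_cancel h, Matrix.trace_mul_comm, mul_assoc]
  have hθ0 : θ.map (d⁄dX A) = 0 := by ext a b; simp [hθ]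
  have ht : d⁄dX A (PowerSeries.X * (J.geom * θ).trace) = (J.geom * J.geom * θ).trace := by
    rw [← smul_eq_mul, ← trace_smul, ← smul_mul_assoc, ← Derivation.trace_matrix_map,
      Derivation.matrix_map_mul, X_smul_geom_map_derivative, hθ0, mul_zero, add_zero]
  rw [eq_neg_iff_add_eq_zero]
  refine PowerSeries.eq_zero_of_derivative_eq_mul (q := -(PowerSeries.C ρ * p)) ?_ ?_
  · have e : PowerSeries.C ρ * PowerSeries.X * w * (J.geom * θ).trace =
      PowerSeries.C ρ * (w * (PowerSeries.X * (J.geom * θ).trace)) := by ring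
    rw [e, map_add, PowerSeries.derivative_coeffwise, hw, ← hp, map_neg, Derivation.leibniz,
      Derivation.leibniz, hDp, Derivation.coeffwise_C, hρ, Derivation.leibniz, Derivation.leibniz,
      ht, hw, ← hp, PowerSeries.derivative_C]
    simp only [smul_eq_mul, map_zero]
    ring
  · have : PowerSeries.constantCoeff (D.coeffwise w) = 0 := by
      rw [← PowerSeries.coeff_zero_eq_constantCoeff_apply, Derivation.coeff_coeffwise,
        PowerSeries.coeff_zero_eq_constantCoeff_apply, hw1]
      simp
    simp [this]

theorem IsDetPow.apply_coeff_succ [Algebra ℂ A] (hw : J.IsDetPow ρ w)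
    (hw1 : PowerSeries.constantCoeff w = 1) (D : Derivation ℂ A A) (hρ : D ρ = 0) (k : ℕ) :
    D (PowerSeries.coeff (k + 1) w) =
      -(ρ * ((w • J.geom).map (PowerSeries.coeff k) * J.map D).trace) := by
  rw [← Derivation.coeff_coeffwise, hw.coeffwise hw1 D hρ]
  have e : PowerSeries.C ρ * PowerSeries.X * w *
      (J.geom * (J.map D).map (PowerSeries.C (R := A))).trace = PowerSeries.X * (PowerSeries.C ρ *
      (w * (J.geom * (J.map D).map (PowerSeries.C (R := A))).trace)) := by ring
  rw [e, map_neg, PowerSeries.coeff_succ_X_mul, PowerSeries.coeff_C_mul]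
  simp [Matrix.trace, Matrix.mul_apply, Finset.mul_sum, ← mul_assoc]

theorem IsDetPow.smul_geom_map_coeffwise [Algebra ℂ A] (hw : J.IsDetPow ρ w)
    (hw1 : PowerSeries.constantCoeff w = 1) (D : Derivation ℂ A A) (hρ : D ρ = 0) :
    (w • J.geom).map D.coeffwise = (PowerSeries.X * w) •
      (J.geom * (J.map D).map (PowerSeries.C (R := A)) * J.geom - (PowerSeries.C ρ *
        (J.geom * (J.map D).map (PowerSeries.C (R := A))).trace) • J.geom) := by
  rw [Derivation.matrix_map_smul, geom_map_coeffwise, hw.coeffwise hw1 D hρ, smul_sub, smul_smul,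
    smul_smul, add_comm, sub_eq_add_neg, ← neg_smul]
  congr 2
  · rw [mul_comm]
  · ring

end Matrix

/-! ### The integrability condition for the gradients, in two spectral variables -/

namespace Matrix

variable {A ι : Type*} [CommRing A] [Fintype ι] [DecidableEq ι]

/-- On the left are the factors produced by differentiating gradients, on the right the factors
whose relevant coefficients vanish. The terms without products of traces agree by cyclicity. The
others agree because both `μ Tr G - ν Tr H` and `μ Tr(Gθ) - ν Tr(Hθ)` are `(μ - ν)` times traces
involving `GH`. -/
theorem trace_resolvent_identity {G H θ : Matrix ι ι A} {μ ν : A} (hGH : Commute G H)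
    (h : μ • G - ν • H = (μ - ν) • (G * H)) (ρ σ : A) :
    ρ * (ν * (G * (H * θ * H - (σ * (H * θ).trace) • H)).trace)
      - σ * (μ * ((G * θ * G - (ρ * (G * θ).trace) • G) * H).trace) =
    ρ * (ν * (G * θ * (H * H - (σ * H.trace) • H)).trace)
      - σ * (μ * ((G * G - (ρ * G.trace) • G) * (H * θ)).trace) := by
  have h1 : μ * G.trace - ν * H.trace = (μ - ν) * (G * H).trace := by
    simpa using congrArg trace h
  have h2 : μ * (G * θ).trace - ν * (H * θ).trace = (μ - ν) * (G * H * θ).trace := by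
    simpa [sub_mul] using congrArg (fun M => (M * θ).trace) h
  have e1 : (G * H * θ * H).trace = (G * θ * H * H).trace := by
    rw [trace_mul_comm, mul_assoc (G * θ), trace_mul_comm (G * θ), ← mul_assoc, ← mul_assoc,
      ← hGH.eq, ← mul_assoc, mul_assoc H H G, ← hGH.eq, ← mul_assoc, ← hGH.eq]
  have e2 : (G * θ * G * H).trace = (G * G * H * θ).trace := by
    rw [mul_assoc (G * θ), mul_assoc G θ, trace_mul_comm, mul_assoc θ, trace_mul_comm,
      mul_assoc G H G, ← hGH.eq, ← mul_assoc]
  have e3 : (G * θ * H).trace = (G * H * θ).trace := by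
    rw [trace_mul_comm, ← mul_assoc, hGH.eq]
  simp only [mul_sub, sub_mul, trace_sub, mul_smul_comm, smul_mul_assoc, trace_smul, smul_eq_mul,
    ← mul_assoc, e1, e2, e3]
  linear_combination (ρ * σ * (G * H).trace) * h2 - (ρ * σ * (G * H * θ).trace) * h1

variable (J : Matrix ι ι A)

theorem commute_geom_geom : Commute (J.geom.map (PowerSeries.C (R := PowerSeries A)))
    (J.geom.map (PowerSeries.map (PowerSeries.C (R := A)))) := by
  ext a b l k
  have h : (J ^ k * J ^ l) a b = (J ^ l * J ^ k) a b := by rw [← pow_add, ← pow_add, add_comm]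
  simpa [Matrix.mul_apply, geom, PowerSeries.coeff_C_mul, PowerSeries.coeff_mul_C] using h

/-- Expanding either factor of `GH` gives `GH = H + μ G K H = G + ν G K H`; the combination that
cancels `G K H` is the identity. -/
theorem resolvent_identity :
    (PowerSeries.C (PowerSeries.X : PowerSeries A)) • J.geom.map (PowerSeries.C (R := PowerSeries A))
      - (PowerSeries.X : PowerSeries (PowerSeries A)) •
        J.geom.map (PowerSeries.map (PowerSeries.C (R := A))) =
    (PowerSeries.C (PowerSeries.X : PowerSeries A) - PowerSeries.X) •
      (J.geom.map (PowerSeries.C (R := PowerSeries A)) *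
        J.geom.map (PowerSeries.map (PowerSeries.C (R := A)))) := by
  set G := J.geom.map (PowerSeries.C (R := PowerSeries A)) with hG
  set H := J.geom.map (PowerSeries.map (PowerSeries.C (R := A))) with hH
  set K := (J.map (PowerSeries.C (R := A))).map (PowerSeries.C (R := PowerSeries A)) with hK
  have h1 : G = 1 + PowerSeries.C (PowerSeries.X : PowerSeries A) • (G * K) := by
    have := congrArg (fun M : Matrix ι ι (PowerSeries A) =>
      (PowerSeries.C (R := PowerSeries A)).mapMatrix M) J.geom_eq'
    simp only [map_add, map_one] at this
    refine this.trans (congrArg (1 + ·) ?_)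
    ext a b : 1
    simp [Matrix.mul_apply, hG, hK]
  have h2 : H = 1 + (PowerSeries.X : PowerSeries (PowerSeries A)) • (K * H) := by
    have := congrArg (fun M : Matrix ι ι (PowerSeries A) =>
      (PowerSeries.map (PowerSeries.C (R := A))).mapMatrix M) J.geom_eq
    simp only [map_add, map_one] at this
    refine this.trans (congrArg (1 + ·) ?_)
    ext a b : 1
    simp [Matrix.mul_apply, hH, hK]
  have h3 : G * H = H + PowerSeries.C (PowerSeries.X : PowerSeries A) • (G * K * H) := by
    conv_lhs => rw [h1, add_mul, one_mul, smul_mul_assoc]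
  have h4 : G * H = G + (PowerSeries.X : PowerSeries (PowerSeries A)) • (G * K * H) := by
    conv_lhs => rw [h2, mul_add, mul_one, mul_smul_comm, ← mul_assoc]
  have h5 := congrArg (fun M => (PowerSeries.X : PowerSeries (PowerSeries A)) • M) h3
  have h6 := congrArg (fun M => PowerSeries.C (PowerSeries.X : PowerSeries A) • M) h4
  simp only [smul_add, smul_smul] at h5 h6
  rw [sub_smul, h5, h6, mul_comm PowerSeries.X]
  abel

variable {J} {ρ σ : A} {w z : PowerSeries A}

theorem smul_map_C (a : PowerSeries A) (M : Matrix ι ι (PowerSeries A)) :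
    (a • M).map (PowerSeries.C (R := PowerSeries A)) =
      PowerSeries.C a • M.map (PowerSeries.C (R := PowerSeries A)) := by
  ext : 1; simp

theorem smul_map_map_C (a : PowerSeries A) (M : Matrix ι ι (PowerSeries A)) :
    (a • M).map (PowerSeries.map (PowerSeries.C (R := A))) =
      PowerSeries.map (PowerSeries.C (R := A)) a •
        M.map (PowerSeries.map (PowerSeries.C (R := A))) := by
  ext : 1; simp

theorem C_trace (M : Matrix ι ι (PowerSeries A)) :
    PowerSeries.C M.trace = (M.map (PowerSeries.C (R := PowerSeries A))).trace := by
  simp [Matrix.trace]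

theorem map_C_trace (M : Matrix ι ι (PowerSeries A)) :
    PowerSeries.map (PowerSeries.C (R := A)) M.trace =
      (M.map (PowerSeries.map (PowerSeries.C (R := A)))).trace := by
  simp [Matrix.trace]

theorem sub_map_C (M N : Matrix ι ι (PowerSeries A)) :
    (M - N).map (PowerSeries.C (R := PowerSeries A)) =
      M.map (PowerSeries.C (R := PowerSeries A)) - N.map (PowerSeries.C (R := PowerSeries A)) := by
  ext : 1; simp

theorem sub_map_map_C (M N : Matrix ι ι (PowerSeries A)) :
    (M - N).map (PowerSeries.map (PowerSeries.C (R := A))) =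
      M.map (PowerSeries.map (PowerSeries.C (R := A))) -
        N.map (PowerSeries.map (PowerSeries.C (R := A))) := by
  ext : 1; simp

/-- `trace_resolvent_identity` multiplied by `w(μ) z(ν)`, with `G = G(μ)` and `H = G(ν)`. -/
theorem trace_geom_identity (J θ₀ : Matrix ι ι A) (ρ σ : A) (w z : PowerSeries A) :
    let θ := θ₀.map (PowerSeries.C (R := A))
    PowerSeries.C (PowerSeries.C ρ) * ((w • J.geom).map (PowerSeries.C (R := PowerSeries A)) *
        ((PowerSeries.X * z) • (J.geom * θ * J.geom - (PowerSeries.C σ * (J.geom * θ).trace) •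
          J.geom)).map (PowerSeries.map (PowerSeries.C (R := A)))).trace -
      PowerSeries.C (PowerSeries.C σ) * (((PowerSeries.X * w) • (J.geom * θ * J.geom -
        (PowerSeries.C ρ * (J.geom * θ).trace) • J.geom)).map (PowerSeries.C (R := PowerSeries A)) *
        (z • J.geom).map (PowerSeries.map (PowerSeries.C (R := A)))).trace =
    PowerSeries.C (PowerSeries.C ρ) *
        ((w • (J.geom * θ)).map (PowerSeries.C (R := PowerSeries A)) *
        ((PowerSeries.X * z) • (J.geom * J.geom - (PowerSeries.C σ * J.geom.trace) •
          J.geom)).map (PowerSeries.map (PowerSeries.C (R := A)))).trace -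
      PowerSeries.C (PowerSeries.C σ) * (((PowerSeries.X * w) • (J.geom * J.geom -
        (PowerSeries.C ρ * J.geom.trace) • J.geom)).map (PowerSeries.C (R := PowerSeries A)) *
        (z • (J.geom * θ)).map (PowerSeries.map (PowerSeries.C (R := A)))).trace := by
  intro θ
  have hΘ : θ.map (PowerSeries.map (PowerSeries.C (R := A))) =
      θ.map (PowerSeries.C (R := PowerSeries A)) := by
    ext a b : 1; simp [θ]
  have key := trace_resolvent_identity (θ := θ.map (PowerSeries.C (R := PowerSeries A)))
    J.commute_geom_geom J.resolvent_identity
    (PowerSeries.C (PowerSeries.C ρ)) (PowerSeries.C (PowerSeries.C σ))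
  simp only [sub_map_C, sub_map_map_C, smul_map_C, smul_map_map_C, map_mul,
    C_trace, map_C_trace, Matrix.map_mul, hΘ, PowerSeries.map_X, PowerSeries.map_C]
  generalize J.geom.map (PowerSeries.C (R := PowerSeries A)) = G at key ⊢
  generalize J.geom.map (PowerSeries.map (PowerSeries.C (R := A))) = H at key ⊢
  generalize θ.map (PowerSeries.C (R := PowerSeries A)) = Θ at key ⊢
  generalize PowerSeries.map (PowerSeries.C (R := A)) z = Z
  simp only [smul_mul_assoc, mul_smul_comm, trace_smul, smul_eq_mul] at key ⊢
  linear_combination (PowerSeries.C w * Z) * key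

/-- The gradients `[μᵏ] wG` and `[μˡ] zG` of the charge densities satisfy an integrability
condition. -/
theorem IsDetPow.trace_mul_map_eq [Algebra ℂ A] (hw : J.IsDetPow ρ w)
    (hw1 : PowerSeries.constantCoeff w = 1) (hz : J.IsDetPow σ z)
    (hz1 : PowerSeries.constantCoeff z = 1) (D : Derivation ℂ A A) (hρ : D ρ = 0) (hσ : D σ = 0)
    {k l : ℕ} (hk : (k : A) = Fintype.card ι * ρ) (hl : (l : A) = Fintype.card ι * σ) :
    ρ * ((w • J.geom).map (PowerSeries.coeff k) *
        ((z • J.geom).map (PowerSeries.coeff l)).map D).trace =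
      σ * ((z • J.geom).map (PowerSeries.coeff l) *
        ((w • J.geom).map (PowerSeries.coeff k)).map D).trace := by
  have hcomm : ∀ (M : Matrix ι ι (PowerSeries A)) (n : ℕ),
      (M.map (PowerSeries.coeff n)).map D = (M.map D.coeffwise).map (PowerSeries.coeff n) := by
    intro M n; ext a b; simp
  rw [hcomm, hcomm, trace_mul_comm ((z • J.geom).map _), hw.smul_geom_map_coeffwise hw1 D hρ,
    hz.smul_geom_map_coeffwise hz1 D hσ]
  -- In the coefficient of `μᵏ νˡ`, both terms on the right contain a factor killed by
  -- `map_coeff_eq_zero`.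
  have key := congrArg (fun f => PowerSeries.coeff k (PowerSeries.coeff l f))
    (trace_geom_identity J (J.map D) ρ σ w z)
  simp only [map_sub, PowerSeries.coeff_C_mul, coeff_coeff_trace_map_C_mul_map_map,
    hw.map_coeff_eq_zero hk, hz.map_coeff_eq_zero hl, mul_zero, zero_mul, trace_zero,
    sub_zero] at key
  exact sub_eq_zero.1 key

end Matrix

/-! ### Coefficients as polynomials in the entries of `J` without constant term -/

namespace Matrix

variable {A ι : Type*} [CommRing A] [Fintype ι] [DecidableEq ι] [Algebra ℂ A]
  {J : Matrix ι ι A} {s : NonUnitalSubalgebra ℂ A}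

theorem pow_succ_apply_mem (hJ : ∀ i j, J i j ∈ s) (n : ℕ) (i j : ι) : (J ^ (n + 1)) i j ∈ s := by
  induction n generalizing i j with
  | zero => simpa using hJ i j
  | succ n ih =>
    rw [pow_succ, mul_apply]
    exact sum_mem fun k _ => mul_mem (ih i k) (hJ k j)

theorem trace_pow_succ_mem (hJ : ∀ i j, J i j ∈ s) (n : ℕ) : (J ^ (n + 1)).trace ∈ s :=
  sum_mem fun i _ => pow_succ_apply_mem hJ n i i

theorem map_coeff_smul_geom (J : Matrix ι ι A) (w : PowerSeries A) (k : ℕ) :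
    (w • J.geom).map (PowerSeries.coeff k) =
      ∑ x ∈ Finset.HasAntidiagonal.antidiagonal k, PowerSeries.coeff x.1 w • J ^ x.2 := by
  ext a b
  simp [PowerSeries.coeff_mul, geom, Matrix.sum_apply]

theorem map_coeff_smul_geom_mem_adjoin (J : Matrix ι ι A) (w : PowerSeries A) (k : ℕ) :
    (w • J.geom).map (PowerSeries.coeff k) ∈ Algebra.adjoin A {J} := by
  rw [map_coeff_smul_geom]
  exact sum_mem fun x _ => Subalgebra.smul_mem _
    (pow_mem (Algebra.subset_adjoin (Set.mem_singleton J)) _) _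

/-- The equation for `w` gives a Newton-type recursion `(n+1) wₙ₊₁ = -r ∑ wᵢ Tr(Jⁿ⁻ⁱ⁺¹)`. The
subalgebra is non-unital because it will consist of the observables that decrease at infinity, which
exclude nonzero constants on the line. -/
theorem IsDetPow.coeff_succ_mem {r : ℂ} {w : PowerSeries A} (hw : J.IsDetPow (algebraMap ℂ A r) w)
    (hw1 : PowerSeries.constantCoeff w = 1) (hJ : ∀ i j, J i j ∈ s) (n : ℕ) :
    PowerSeries.coeff (n + 1) w ∈ s := by
  induction n using Nat.strong_induction_on with
  | _ n ih =>
    have h := congrArg (PowerSeries.coeff n) hw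
    have hp : ∀ k, PowerSeries.coeff k (J.geom * J.map (PowerSeries.C (R := A))).trace =
        (J ^ (k + 1)).trace := by
      intro k; simp [Matrix.trace, Matrix.mul_apply, pow_succ, geom]
    rw [PowerSeries.coeff_derivative, map_neg, mul_assoc, PowerSeries.coeff_C_mul,
      PowerSeries.coeff_mul] at h
    have e : PowerSeries.coeff (n + 1) w = (-((n : ℂ) + 1)⁻¹ * r) •
        ∑ x ∈ Finset.HasAntidiagonal.antidiagonal n, PowerSeries.coeff x.1 w * (J ^ (x.2 + 1)).trace := by
      simp only [← hp]
      have h2 : algebraMap ℂ A ((n : ℂ) + 1)⁻¹ * ((n : A) + 1) = 1 := by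
        have : ((n : A) + 1) = algebraMap ℂ A ((n : ℂ) + 1) := by simp
        rw [this, ← map_mul, inv_mul_cancel₀ (Nat.cast_add_one_ne_zero n), map_one]
      rw [Algebra.smul_def, map_mul, map_neg]
      linear_combination (algebraMap ℂ A ((n : ℂ) + 1)⁻¹) * h
        - PowerSeries.coeff (n + 1) w * h2
    rw [e]
    refine SMulMemClass.smul_mem _ (sum_mem fun x hx => ?_)
    rcases h1 : x.1 with _ | k
    · rw [PowerSeries.coeff_zero_eq_constantCoeff_apply, hw1, one_mul]
      exact trace_pow_succ_mem hJ _
    · refine mul_mem (ih k ?_) (trace_pow_succ_mem hJ _)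
      have := Finset.HasAntidiagonal.mem_antidiagonal.1 hx
      omega

/-- In positive degree no summand `wᵢ Jʲ` has `i = j = 0`, so no constant term appears. -/
theorem IsDetPow.map_coeff_succ_mem {r : ℂ} {w : PowerSeries A}
    (hw : J.IsDetPow (algebraMap ℂ A r) w) (hw1 : PowerSeries.constantCoeff w = 1)
    (hJ : ∀ i j, J i j ∈ s) (n : ℕ) (i j : ι) :
    (w • J.geom).map (PowerSeries.coeff (n + 1)) i j ∈ s := by
  rw [map_coeff_smul_geom, Matrix.sum_apply]
  refine sum_mem fun x hx => ?_
  have hx := Finset.HasAntidiagonal.mem_antidiagonal.1 hx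
  rw [smul_apply, smul_eq_mul]
  rcases h1 : x.1 with _ | k
  · rw [PowerSeries.coeff_zero_eq_constantCoeff_apply, hw1, one_mul]
    obtain rfl : x = (0, n + 1) := by ext <;> simp <;> omega
    exact pow_succ_apply_mem hJ n i j
  · have hk := hw.coeff_succ_mem hw1 hJ k
    rcases x.2 with _ | l
    · rw [pow_zero, one_apply]
      split_ifs
      · simpa using hk
      · simp
    · exact mul_mem hk (pow_succ_apply_mem hJ l i j)

theorem IsSkewAdjoint.pow_of_odd {R : Type*} [CommRing R] {B M : Matrix ι ι R}
    (h : B.IsSkewAdjoint M) {k : ℕ} (hk : Odd k) : B.IsSkewAdjoint (M ^ k) := by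
  have h' : Mᵀ * B = B * -M := h
  have : ∀ n : ℕ, (Mᵀ) ^ n * B = B * (-M) ^ n := by
    intro n
    induction n with
    | zero => simp
    | succ n ih => rw [pow_succ, mul_assoc, h', ← mul_assoc, ih, mul_assoc, ← pow_succ]
  change (M ^ k)ᵀ * B = B * -(M ^ k)
  rw [transpose_pow, this, hk.neg_pow]

end Matrix

attribute [local instance] LieRing.ofAssociativeRing

/-! ### Densities and gradients for the classical Lie algebras -/

namespace ClassicalType

variable {A : Type*} [CommRing A] [Algebra ℂ A]

/-- The power of `det (1 - μ J)` whose coefficient of `μⁿ` is the density of degree `n`. -/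
def detPow {ι : Type*} [Fintype ι] [DecidableEq ι] (J : Matrix ι ι A) (r : ℂ) : PowerSeries A :=
  seriesPow (1 - (PowerSeries.X : PowerSeries A) • J.map (PowerSeries.C (R := A))).det r

theorem constantCoeff_detPow {ι : Type*} [Fintype ι] [DecidableEq ι] (J : Matrix ι ι A) (r : ℂ) :
    PowerSeries.constantCoeff (detPow J r) = 1 :=
  constantCoeff_seriesPow J.constantCoeff_det_one_sub r

theorem isDetPow_detPow {ι : Type*} [Fintype ι] [DecidableEq ι] (J : Matrix ι ι A) (r : ℂ) :
    J.IsDetPow (algebraMap ℂ A r) (detPow J r) :=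
  J.isDetPow_seriesPow r

/-- The gradient of the density of degree `n` with respect to the entries of `J`. -/
def gradient : (t : ClassicalType) → Matrix t.Idx t.Idx A → ℕ → Matrix t.Idx t.Idx A
  | .A d _, J, n => (-(((n : ℂ) - 1) / (d : ℂ))) •
      ((detPow J (((n : ℂ) - 1) / (d : ℂ)) • J.geom).map (PowerSeries.coeff (n - 1)))
  | .BD _, J, n => (n : ℂ) • J ^ (n - 1)
  | .C _, J, n => (n : ℂ) • J ^ (n - 1)

theorem two_le_of_mem_degrees {t : ClassicalType} {n : ℕ} (hn : n ∈ t.degrees) : 2 ≤ n := by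
  cases t <;> exact hn.1

theorem derivation_trace_pow {ι : Type*} [Fintype ι] [DecidableEq ι] (D : Derivation ℂ A A)
    (J : Matrix ι ι A) (n : ℕ) : D (J ^ n).trace = (((n : ℂ) • J ^ (n - 1)) * J.map D).trace := by
  rw [← D.trace_matrix_map]
  have := D.trace_mul_map_pow (M := J) (Y := 1) (Commute.one_left J) n
  rwa [one_mul, one_mul, ← Nat.cast_smul_eq_nsmul ℂ, ← Matrix.trace_smul, ← smul_mul_assoc] at this

theorem derivation_density (D : Derivation ℂ A A) (t : ClassicalType) (J : Matrix t.Idx t.Idx A)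
    {n : ℕ} (hn : n ∈ t.degrees) :
    D (t.density J n) = (t.gradient J n * J.map D).trace := by
  have h2 := two_le_of_mem_degrees hn
  cases t with
  | A d hd =>
    obtain ⟨k, rfl⟩ := Nat.exists_eq_add_of_le' h2
    have := (isDetPow_detPow J _).apply_coeff_succ (constantCoeff_detPow J
      ((((k + 2 : ℕ) : ℂ) - 1) / (d : ℂ))) D (D.map_algebraMap _) (k + 1)
    rw [← Algebra.smul_def, ← Matrix.trace_smul, ← Matrix.trace_neg, ← smul_mul_assoc, ← neg_mul,
      ← neg_smul] at this
    exact this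
  | BD N => exact derivation_trace_pow D J n
  | C N => exact derivation_trace_pow D J n

/-- Both sides are `n(n-1)m(m-1) Tr(Jⁿ⁺ᵐ⁻³ D J)`. -/
theorem trace_pow_mul_map_pow {ι : Type*} [Fintype ι] [DecidableEq ι] (D : Derivation ℂ A A)
    (J : Matrix ι ι A) (n m : ℕ) :
    ((n - 1 : ℕ) : ℂ) • (((n : ℂ) • J ^ (n - 1)) * ((m : ℂ) • J ^ (m - 1)).map D).trace =
    ((m - 1 : ℕ) : ℂ) • (((m : ℂ) • J ^ (m - 1)) * ((n : ℂ) • J ^ (n - 1)).map D).trace := by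
  have hs : ∀ (c : ℂ) (M : Matrix ι ι A), (c • M).map D = c • M.map D := by
    intro c M; ext; simp
  simp only [hs, smul_mul_assoc, mul_smul_comm, Matrix.trace_smul,
    D.trace_mul_map_pow ((Commute.refl J).pow_left _), ← Nat.cast_smul_eq_nsmul ℂ, smul_smul,
    ← pow_add]
  rcases n with _ | _ | n
  · simp
  · simp
  rcases m with _ | _ | m
  · simp
  · simp
  congr 1
  · ring
  · congr 3
    omega

/-- For `D = ∂_x` this turns `Tr(U ∂V)` into a multiple of `∂ Tr(UV)`, which is what makes the
charges commute. -/
theorem gradient_integrability (D : Derivation ℂ A A) (t : ClassicalType)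
    (J : Matrix t.Idx t.Idx A) {n m : ℕ} (hn : n ∈ t.degrees) (hm : m ∈ t.degrees) :
    ((n - 1 : ℕ) : ℂ) • (t.gradient J n * (t.gradient J m).map D).trace =
      ((m - 1 : ℕ) : ℂ) • (t.gradient J m * (t.gradient J n).map D).trace := by
  have h2 := two_le_of_mem_degrees hn
  have h2' := two_le_of_mem_degrees hm
  cases t with
  | A d hd =>
    have hd0 : (d : ℂ) ≠ 0 := by exact_mod_cast (by omega : d ≠ 0)
    have hs : ∀ (c : ℂ) (M : Matrix (Fin d) (Fin d) A), (c • M).map D = c • M.map D := by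
      intro c M; ext; simp
    have hk : ∀ n : ℕ, 2 ≤ n → ((n - 1 : ℕ) : ℂ) = d * (((n : ℂ) - 1) / d) := by
      intro n hn
      rw [mul_div_cancel₀ _ hd0, Nat.cast_sub (by omega), Nat.cast_one]
    have hk' : ∀ n : ℕ, 2 ≤ n →
        ((n - 1 : ℕ) : A) = Fintype.card (Fin d) * algebraMap ℂ A (((n : ℂ) - 1) / d) := by
      intro n hn
      rw [← map_natCast (algebraMap ℂ A), hk n hn, map_mul, map_natCast, Fintype.card_fin]
    have key := (isDetPow_detPow J (((n : ℂ) - 1) / d)).trace_mul_map_eq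
      (constantCoeff_detPow J _) (isDetPow_detPow J (((m : ℂ) - 1) / d)) (constantCoeff_detPow J _)
      D (D.map_algebraMap _) (D.map_algebraMap _) (hk' n h2) (hk' m h2')
    simp only [← Algebra.smul_def] at key
    simp only [gradient, hk n h2, hk m h2']
    erw [hs, hs]
    simp only [smul_mul_assoc, mul_smul_comm, Matrix.trace_smul, smul_smul]
    -- The factor is `d` times the product of the two exponents: one factor from each gradient's
    -- normalisation, and `n - 1 = dρ` or `m - 1 = dσ` in front.
    have := congrArg (fun a => ((d : ℂ) * (((n : ℂ) - 1) / d) * (((m : ℂ) - 1) / d)) • a) key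
    simp only [smul_smul] at this
    convert this using 2 <;> ring
  | BD N => exact trace_pow_mul_map_pow D J n m
  | C N => exact trace_pow_mul_map_pow D J n m

theorem gradient_mem_adjoin (t : ClassicalType) (J : Matrix t.Idx t.Idx A) (n : ℕ) :
    t.gradient J n ∈ Algebra.adjoin A {J} := by
  have hp : ∀ k, J ^ k ∈ Algebra.adjoin A {J} := fun k =>
    pow_mem (Algebra.subset_adjoin (Set.mem_singleton J)) k
  cases t with
  | A d hd =>
    rw [gradient, ← algebraMap_smul A]
    exact Subalgebra.smul_mem _ (Matrix.map_coeff_smul_geom_mem_adjoin J _ _) _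
  | BD N => rw [gradient, ← algebraMap_smul A]; exact Subalgebra.smul_mem _ (hp _) _
  | C N => rw [gradient, ← algebraMap_smul A]; exact Subalgebra.smul_mem _ (hp _) _

theorem commute_gradient_gradient (t : ClassicalType) (J : Matrix t.Idx t.Idx A) (n m : ℕ) :
    Commute (t.gradient J n) (t.gradient J m) :=
  Algebra.commute_of_mem_adjoin_singleton_of_commute (gradient_mem_adjoin t J m)
    (Algebra.commute_of_mem_adjoin_singleton_of_commute (gradient_mem_adjoin t J n)
      (Commute.refl J)).symm

theorem commute_gradient (t : ClassicalType) (J : Matrix t.Idx t.Idx A) (n : ℕ) :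
    Commute (t.gradient J n) J :=
  (Algebra.commute_of_mem_adjoin_singleton_of_commute (gradient_mem_adjoin t J n)
      (Commute.refl J)).symm

theorem density_mem {s : NonUnitalSubalgebra ℂ A} (t : ClassicalType) {J : Matrix t.Idx t.Idx A}
    (hJ : ∀ i j, J i j ∈ s) {n : ℕ} (hn : n ∈ t.degrees) : t.density J n ∈ s := by
  obtain ⟨k, rfl⟩ := Nat.exists_eq_add_of_le' (two_le_of_mem_degrees hn)
  cases t with
  | A d hd => exact (isDetPow_detPow J _).coeff_succ_mem (constantCoeff_detPow J _) hJ (k + 1)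
  | BD N => exact Matrix.trace_pow_succ_mem hJ (k + 1)
  | C N => exact Matrix.trace_pow_succ_mem hJ (k + 1)

theorem gradient_apply_mem {s : NonUnitalSubalgebra ℂ A} (t : ClassicalType)
    {J : Matrix t.Idx t.Idx A} (hJ : ∀ i j, J i j ∈ s) {n : ℕ} (hn : n ∈ t.degrees) (i j : t.Idx) :
    t.gradient J n i j ∈ s := by
  obtain ⟨k, rfl⟩ := Nat.exists_eq_add_of_le' (two_le_of_mem_degrees hn)
  cases t with
  | A d hd =>
    exact SMulMemClass.smul_mem _ ((isDetPow_detPow J _).map_coeff_succ_mem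
      (constantCoeff_detPow J _) hJ k i j)
  | BD N => exact SMulMemClass.smul_mem _ (Matrix.pow_succ_apply_mem hJ k i j)
  | C N => exact SMulMemClass.smul_mem _ (Matrix.pow_succ_apply_mem hJ k i j)

/-- In type A the exponent `(n-1)/d` makes the gradient traceless; in the other types it is an odd
power of a skew-adjoint matrix. Membership in `𝔤` is what lets the Casimir tensor act on the
gradient as the identity. -/
theorem gradient_map_mem_alg (t : ClassicalType) (J : Matrix t.Idx t.Idx A) (e : A →ₐ[ℂ] ℂ)
    (hJ : J.map e ∈ t.alg) {n : ℕ} (hn : n ∈ t.degrees) : (t.gradient J n).map e ∈ t.alg := by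
  have h2 := two_le_of_mem_degrees hn
  have hpow : ∀ k : ℕ, ((n : ℂ) • J ^ k).map e = (n : ℂ) • (J.map e) ^ k := by
    intro k
    ext i j
    have := congrFun (congrFun (map_pow (e : A →+* ℂ).mapMatrix J k) i) j
    simp only [RingHom.mapMatrix_apply, Matrix.map_apply] at this
    simp only [Matrix.map_apply, Matrix.smul_apply, map_smul]
    exact congrArg _ this
  have hskew : ∀ {ι : Type} [Fintype ι] [DecidableEq ι] {B M : Matrix ι ι ℂ},
      M ∈ skewAdjointMatricesLieSubalgebra B → Even n →
      M ^ (n - 1) ∈ skewAdjointMatricesLieSubalgebra B := by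
    intro ι _ _ B M hM hn
    rw [mem_skewAdjointMatricesLieSubalgebra, mem_skewAdjointMatricesSubmodule] at hM ⊢
    exact hM.pow_of_odd (Nat.Even.sub_odd (by omega) hn odd_one)
  cases t with
  | A d hd =>
    have hd0 : (d : ℂ) ≠ 0 := by exact_mod_cast (by omega : d ≠ 0)
    have hk : ((n - 1 : ℕ) : A) = Fintype.card (Fin d) * algebraMap ℂ A (((n : ℂ) - 1) / d) := by
      rw [← map_natCast (algebraMap ℂ A), ← map_natCast (algebraMap ℂ A), ← map_mul,
        Fintype.card_fin, mul_div_cancel₀ _ hd0, Nat.cast_sub (by omega), Nat.cast_one]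
    have h := (isDetPow_detPow J _).coeff_mul_trace_geom hk
    have ht : (gradient (.A d hd) J n).trace = 0 := by
      have e : (gradient (.A d hd) J n).trace = -PowerSeries.coeff (n - 1)
          (PowerSeries.C (algebraMap ℂ A (((n : ℂ) - 1) / d)) *
          detPow J (((n : ℂ) - 1) / d) * J.geom.trace) := by
        rw [mul_assoc, PowerSeries.coeff_C_mul, ← Algebra.smul_def]
        simp [gradient, Matrix.trace, Finset.mul_sum, Finset.smul_sum]
      rw [e, h, neg_zero]
    change (((gradient (.A d hd) J n).map e)).trace = 0
    have := congrArg e ht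
    simpa [Matrix.trace] using this
  | BD N =>
    change ((n : ℂ) • J ^ (n - 1)).map e ∈ _
    rw [hpow]
    exact LieSubalgebra.smul_mem _ _ (hskew hJ hn.2)
  | C N =>
    change ((n : ℂ) • J ^ (n - 1)).map e ∈ _
    rw [hpow]
    exact LieSubalgebra.smul_mem _ _ (hskew hJ hn.2)

end ClassicalType

/-! ### Decrease at infinity, total derivatives, and brackets of functions of a field -/

/-- A differentiable function on the line which is integrable together with its derivative is
bounded. -/
theorem MeasureTheory.Integrable.exists_norm_le_of_integrable_deriv {f : ℝ → ℂ}
    (hf : ContDiff ℝ (⊤ : ℕ∞) f) (hf' : Integrable (deriv f)) : ∃ c, ∀ x, ‖f x‖ ≤ c := by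
  refine ⟨‖f 0‖ + ∫ x, ‖deriv f x‖, fun x => ?_⟩
  have h : ∫ y in (0 : ℝ)..x, deriv f y = f x - f 0 :=
    intervalIntegral.integral_deriv_eq_sub (fun y _ => (hf.differentiable (by simp)).differentiableAt)
      hf'.intervalIntegrable
  have h2 : ‖∫ y in (0 : ℝ)..x, deriv f y‖ ≤ ∫ x, ‖deriv f x‖ :=
    (intervalIntegral.norm_integral_le_integral_norm_uIoc).trans
      (setIntegral_le_integral hf'.norm (Eventually.of_forall fun _ => norm_nonneg _))
  calc ‖f x‖ = ‖f 0 + (f x - f 0)‖ := by congr 1; ring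
    _ ≤ ‖f 0‖ + ‖f x - f 0‖ := norm_add_le _ _
    _ ≤ _ := by rw [← h]; gcongr

namespace FieldTheory

variable {M : Type*} (F : FieldTheory M)

/-- The value of observables at a field configuration and a point. -/
def evalAt (p : M) (x : ℝ) : F.obs →ₐ[ℂ] ℂ :=
  ((Pi.evalAlgHom ℂ (fun _ : ℝ => ℂ) x).comp (Pi.evalAlgHom ℂ (fun _ : M => ℝ → ℂ) p)).comp
    F.obs.val

@[simp]
theorem evalAt_apply (p : M) (x : ℝ) (f : F.obs) : F.evalAt p x f = f.1 p x := rfl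

theorem continuous_evalAt (p : M) (x : ℝ) : Continuous (F.evalAt p x) := F.continuous_apply p x

variable {F} in
theorem ext_evalAt {f g : F.obs} (h : ∀ p x, F.evalAt p x f = F.evalAt p x g) : f = g :=
  Subtype.ext (funext fun p => funext fun x => h p x)

theorem differentiableAt (f : F.obs) (p : M) (x : ℝ) : DifferentiableAt ℝ (f.1 p) x :=
  ((F.smooth f p).differentiable (by simp)).differentiableAt

/-- The space derivative as a derivation. -/
def dxDerivation : Derivation ℂ F.obs F.obs :=
  Derivation.mk'
    { toFun := F.dx
      map_add' := fun f g => ext_evalAt fun p x => by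
        simp only [evalAt_apply, dx_apply, map_add]
        exact deriv_add (F.differentiableAt f p x) (F.differentiableAt g p x)
      map_smul' := fun r f => ext_evalAt fun p x => by
        simp only [evalAt_apply, dx_apply, RingHom.id_apply, map_smul]
        exact deriv_const_smul r (F.differentiableAt f p x) }
    fun f g => ext_evalAt fun p x => by
      simp only [LinearMap.coe_mk, AddHom.coe_mk, smul_eq_mul, map_add, map_mul, evalAt_apply,
        dx_apply]
      refine (deriv_mul (F.differentiableAt f p x) (F.differentiableAt g p x)).trans ?_
      ring

@[simp]
theorem dxDerivation_apply (f : F.obs) : F.dxDerivation f = F.dx f := rfl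

/-- The coefficient of `∂_xᵏ δ_xy` in the bracket `{f(x), g(y)}`, as a derivation in `f`. -/
def brDerivation (g : F.obs) (k : ℕ) : Derivation ℂ F.obs F.obs :=
  Derivation.mk'
    { toFun := fun f => (F.br f g).coeff k
      map_add' := fun f h => by simp
      map_smul' := fun r f => by simp }
    fun f h => by simp [F.leibniz]

@[simp]
theorem brDerivation_apply (g : F.obs) (k : ℕ) (f : F.obs) :
    F.brDerivation g k f = (F.br f g).coeff k := rfl

/-- Observables that decrease at infinity. -/
def decreasing : NonUnitalSubalgebra ℂ F.obs where
  carrier := {f | F.Decreases f}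
  zero_mem' := fun _ p => by
    have h : (0 : F.obs).1 p = fun _ => 0 := rfl
    rw [h]
    simp
  add_mem' := fun {f g} hf hg hs p => by
    have h : deriv ((f + g).1 p) = deriv (f.1 p) + deriv (g.1 p) := funext fun x =>
      deriv_add (F.differentiableAt f p x) (F.differentiableAt g p x)
    exact ⟨(hf hs p).1.add (hg hs p).1, h ▸ (hf hs p).2.add (hg hs p).2⟩
  smul_mem' := fun c f hf hs p => by
    have h : deriv ((c • f).1 p) = c • deriv (f.1 p) := funext fun x =>
      deriv_const_smul c (F.differentiableAt f p x)
    exact ⟨(hf hs p).1.smul c, h ▸ (hf hs p).2.smul c⟩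
  mul_mem' := fun {f g} hf hg hs p => by
    have h : deriv ((f * g).1 p) = deriv (f.1 p) * g.1 p + f.1 p * deriv (g.1 p) := funext fun x =>
      deriv_mul (F.differentiableAt f p x) (F.differentiableAt g p x)
    -- Each factor is bounded because its derivative is integrable, so products with an integrable
    -- function stay integrable.
    obtain ⟨c, hc⟩ := Integrable.exists_norm_le_of_integrable_deriv (F.smooth f p) (hf hs p).2
    obtain ⟨c', hc'⟩ := Integrable.exists_norm_le_of_integrable_deriv (F.smooth g p) (hg hs p).2
    have hb : ∀ u, Integrable u → Integrable (f.1 p * u) := fun u hu =>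
      hu.bdd_mul (F.smooth f p).continuous.aestronglyMeasurable (Eventually.of_forall hc)
    have hb' : ∀ u, Integrable u → Integrable (u * g.1 p) := fun u hu =>
      hu.mul_bdd (F.smooth g p).continuous.aestronglyMeasurable (Eventually.of_forall hc')
    exact ⟨hb _ (hg hs p).1, h ▸ (hb' _ (hf hs p).2).add (hb _ (hg hs p).2)⟩

theorem mem_decreasing {f : F.obs} : f ∈ F.decreasing ↔ F.Decreases f := Iff.rfl

theorem integrable_of_continuous {u : ℝ → ℂ} (hu : Continuous u)
    (h : F.space = .line → Integrable u) : Integrable u F.space.measure := by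
  rcases hs : F.space with _ | _
  · exact (hu.integrableOn_Icc).mono_set Set.Ioc_subset_Icc_self
  · exact h hs

variable {F}

theorem Decreases.hasCharge {f : F.obs} (hf : F.Decreases f) : F.HasCharge f := fun p =>
  F.integrable_of_continuous (F.smooth f p).continuous fun hs => (hf hs p).1

theorem Decreases.integrable_dx {f : F.obs} (hf : F.Decreases f) (p : M) :
    Integrable ((F.dx f).1 p) F.space.measure :=
  F.integrable_of_continuous (F.smooth _ p).continuous fun hs =>
    (funext fun x => F.dx_apply f p x : (F.dx f).1 p = _) ▸ (hf hs p).2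

theorem Decreases.integral_dx {f : F.obs} (hf : F.Decreases f) (p : M) :
    ∫ x, (F.dx f).1 p x ∂F.space.measure = 0 := by
  have hd : ∀ x, HasDerivAt (f.1 p) ((F.dx f).1 p x) x := fun x => by
    rw [F.dx_apply]; exact (F.differentiableAt f p x).hasDerivAt
  have hi := hf.integrable_dx p
  rcases hs : F.space with _ | _
  · rw [hs] at hi
    have h := intervalIntegral.integral_eq_sub_of_hasDerivAt (a := 0) (b := 2 * Real.pi)
      (fun x _ => hd x) ((F.smooth (F.dx f) p).continuous.intervalIntegrable _ _)
    rw [intervalIntegral.integral_of_le Real.two_pi_pos.le] at h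
    have hp := F.periodic hs f p 0
    rw [zero_add] at hp
    rw [Space.measure, h, hp, sub_self]
  · have h2 := (hf hs p).1
    rw [hs] at hi
    exact integral_eq_zero_of_hasDerivAt_of_integrable hd hi h2

/-- The test function is `1`, so every derivative of `δ` integrates to zero. -/
theorem chargeBracketDensity_eq (f g : F.obs) (p : M) :
    F.chargeBracketDensity f g p = ((F.br f g).coeff 0).1 p := by
  funext x
  have h : ∀ k : ℕ, iteratedDeriv k (fun _ : ℝ => (1 : ℂ)) x = if k = 0 then 1 else 0 := by
    intro k
    rw [iteratedDeriv_const]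
  rw [chargeBracketDensity, smearedDensity, one_mul, Polynomial.sum_def]
  simp only [h, mul_ite, mul_one, mul_zero]
  rw [Finset.sum_ite_eq']
  split_ifs with h0
  · rfl
  · rw [Polynomial.notMem_support_iff.1 h0]; rfl

theorem skew_of_coeff_eq_zero {f g : F.obs} (h : ∀ k, 2 ≤ k → (F.br f g).coeff k = 0) :
    (F.br g f).coeff 0 = -(F.br f g).coeff 0 + F.dx ((F.br f g).coeff 1) ∧
      (F.br g f).coeff 1 = (F.br f g).coeff 1 ∧ ∀ k, 2 ≤ k → (F.br g f).coeff k = 0 := by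
  have hdeg : (F.br f g).natDegree < 2 := by
    rcases Nat.lt_or_ge (F.br f g).natDegree 2 with h2 | h2
    · exact h2
    · have h3 := h _ h2
      rw [Polynomial.coeff_natDegree, Polynomial.leadingCoeff_eq_zero] at h3
      rw [h3]; simp
  have hdx : ∀ n, F.dx^[n] 0 = 0 := fun n =>
    Function.iterate_fixed (F.dxDerivation.map_zero) n
  have hsk : ∀ j, (F.br g f).coeff j = -∑ k ∈ Finset.range 2,
      ((-1 : ℤ) ^ k * (k.choose j : ℤ)) • F.dx^[k - j] ((F.br f g).coeff k) := fun j => by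
    rw [F.skew, Polynomial.sum_over_range' _ (fun n => by simp [hdx]) 2 hdeg]
  refine ⟨?_, ?_, fun k hk => ?_⟩
  · rw [hsk]; simp [Finset.sum_range_succ]; ring
  · rw [hsk]; simp [Finset.sum_range_succ]; ring
  · rw [hsk]
    simp [Finset.sum_range_succ, Nat.choose_eq_zero_of_lt (show 0 < k by omega),
      Nat.choose_eq_zero_of_lt (show 1 < k by omega)]

variable {ι : Type*} [Fintype ι] [DecidableEq ι]

/-- `{f(x), g(y)}` for functions `f`, `g` of a field `J`, with gradients `U`, `V`. -/
theorem br_coeff_zero_of_gradient {J U V : Matrix ι ι F.obs} {f g : F.obs}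
    (hf : ∀ D : Derivation ℂ F.obs F.obs, D f = (U * J.map D).trace)
    (hg : ∀ D : Derivation ℂ F.obs F.obs, D g = (V * J.map D).trace)
    (hJ : ∀ i j k l q, 2 ≤ q → (F.br (J i j) (J k l)).coeff q = 0) :
    (F.br f g).coeff 0 =
      (∑ c, ∑ d, V c d * ∑ a, ∑ b, U a b * (F.br (J b a) (J d c)).coeff 0) +
        ∑ c, ∑ d, F.dx (V c d) * ∑ a, ∑ b, U a b * (F.br (J b a) (J d c)).coeff 1 := by
  -- The Leibniz rule is available in the first argument only, so the second argument is expanded by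
  -- passing to `{g, f}` and back with skew-symmetry. The second swap produces the derivative `∂_x
  -- V`.
  have hf' : ∀ h q, (F.br f h).coeff q = ∑ a, ∑ b, U a b * (F.br (J b a) h).coeff q := fun h q => by
    have := hf (F.brDerivation h q)
    simpa [Matrix.trace, Matrix.mul_apply] using this
  have hg' : ∀ h q, (F.br g h).coeff q = ∑ a, ∑ b, V a b * (F.br (J b a) h).coeff q := fun h q => by
    have := hg (F.brDerivation h q)
    simpa [Matrix.trace, Matrix.mul_apply] using this
  have h1 : ∀ k l, ∀ q, 2 ≤ q → (F.br f (J k l)).coeff q = 0 := fun k l q hq => by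
    rw [hf']
    exact Finset.sum_eq_zero fun a _ => Finset.sum_eq_zero fun b _ => by
      rw [hJ _ _ _ _ _ hq, mul_zero]
  have h2 := fun k l => skew_of_coeff_eq_zero (h1 k l)
  have h3 : ∀ q, 2 ≤ q → (F.br g f).coeff q = 0 := fun q hq => by
    rw [hg']
    exact Finset.sum_eq_zero fun a _ => Finset.sum_eq_zero fun b _ => by
      rw [(h2 _ _).2.2 q hq, mul_zero]
  rw [(skew_of_coeff_eq_zero h3).1, hg', hg']
  simp only [(h2 _ _).1, (h2 _ _).2.1, ← hf', ← dxDerivation_apply, map_sum, Derivation.leibniz,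
    ← Finset.sum_neg_distrib, ← Finset.sum_add_distrib, smul_eq_mul]
  refine Finset.sum_congr rfl fun c _ => Finset.sum_congr rfl fun d _ => ?_
  ring

end FieldTheory

/-! ### Commutators of tensors with matrices in one factor -/

namespace Matrix

variable {ι : Type*} [Fintype ι] [DecidableEq ι]

/-- The commutator `[R₁₂, Y₁]`. -/
def commFst (R : Matrix (ι × ι) (ι × ι) ℂ) (Y : Matrix ι ι ℂ) : Matrix (ι × ι) (ι × ι) ℂ :=
  R * (Y ⊗ₖ (1 : Matrix ι ι ℂ)) - (Y ⊗ₖ (1 : Matrix ι ι ℂ)) * R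

/-- The commutator `[R₁₂, Y₂]`. -/
def commSnd (R : Matrix (ι × ι) (ι × ι) ℂ) (Y : Matrix ι ι ℂ) : Matrix (ι × ι) (ι × ι) ℂ :=
  R * ((1 : Matrix ι ι ℂ) ⊗ₖ Y) - ((1 : Matrix ι ι ℂ) ⊗ₖ Y) * R

theorem commFst_smul_left (a : ℂ) (R : Matrix (ι × ι) (ι × ι) ℂ) (Y : Matrix ι ι ℂ) :
    commFst (a • R) Y = a • commFst R Y := by
  simp [commFst, smul_sub]

theorem commSnd_smul_left (a : ℂ) (R : Matrix (ι × ι) (ι × ι) ℂ) (Y : Matrix ι ι ℂ) :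
    commSnd (a • R) Y = a • commSnd R Y := by
  simp [commSnd, smul_sub]

theorem commFst_smul_right (a : ℂ) (R : Matrix (ι × ι) (ι × ι) ℂ) (Y : Matrix ι ι ℂ) :
    commFst R (a • Y) = a • commFst R Y := by
  simp [commFst, smul_sub, smul_kronecker]

theorem commSnd_smul_right (a : ℂ) (R : Matrix (ι × ι) (ι × ι) ℂ) (Y : Matrix ι ι ℂ) :
    commSnd R (a • Y) = a • commSnd R Y := by
  simp [commSnd, smul_sub, kronecker_smul]

theorem tendsto_kronecker {α : Type*} {l : Filter α} {Y Z : α → Matrix ι ι ℂ}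
    {Y₀ Z₀ : Matrix ι ι ℂ} (hY : Tendsto Y l (𝓝 Y₀)) (hZ : Tendsto Z l (𝓝 Z₀)) :
    Tendsto (fun a => Y a ⊗ₖ Z a) l (𝓝 (Y₀ ⊗ₖ Z₀)) := by
  refine tendsto_pi_nhds.2 fun a => tendsto_pi_nhds.2 fun b => ?_
  exact (tendsto_pi_nhds.1 (tendsto_pi_nhds.1 hY a.1) b.1).mul
    (tendsto_pi_nhds.1 (tendsto_pi_nhds.1 hZ a.2) b.2)

theorem tendsto_commFst {α : Type*} {l : Filter α} {R : α → Matrix (ι × ι) (ι × ι) ℂ}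
    {R₀ : Matrix (ι × ι) (ι × ι) ℂ} {Y : α → Matrix ι ι ℂ} {Y₀ : Matrix ι ι ℂ}
    (hR : Tendsto R l (𝓝 R₀)) (hY : Tendsto Y l (𝓝 Y₀)) :
    Tendsto (fun a => commFst (R a) (Y a)) l (𝓝 (commFst R₀ Y₀)) := by
  have h := tendsto_kronecker hY (tendsto_const_nhds (x := (1 : Matrix ι ι ℂ)))
  exact (hR.mul h).sub (h.mul hR)

theorem tendsto_commSnd {α : Type*} {l : Filter α} {R : α → Matrix (ι × ι) (ι × ι) ℂ}
    {R₀ : Matrix (ι × ι) (ι × ι) ℂ} {Y : α → Matrix ι ι ℂ} {Y₀ : Matrix ι ι ℂ}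
    (hR : Tendsto R l (𝓝 R₀)) (hY : Tendsto Y l (𝓝 Y₀)) :
    Tendsto (fun a => commSnd (R a) (Y a)) l (𝓝 (commSnd R₀ Y₀)) := by
  have h := tendsto_kronecker (tendsto_const_nhds (x := (1 : Matrix ι ι ℂ))) hY
  exact (hR.mul h).sub (h.mul hR)

theorem tendsto_trace_mul {α κ : Type*} [Fintype κ] {l : Filter α} {A : α → Matrix κ κ ℂ}
    {A₀ : Matrix κ κ ℂ} (hA : Tendsto A l (𝓝 A₀)) (W : Matrix κ κ ℂ) :
    Tendsto (fun a => (A a * W).trace) l (𝓝 (A₀ * W).trace) :=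
  ((continuous_id.mul continuous_const).matrix_trace.tendsto A₀).comp hA

/-- Cyclicity moves the commutator from `R` to the test matrix, so it vanishes when `U` commutes
with `Y`. -/
theorem trace_commFst_mul_kronecker (R : Matrix (ι × ι) (ι × ι) ℂ) (Y U V : Matrix ι ι ℂ) :
    (commFst R Y * (U ⊗ₖ V)).trace = (R * ((Y * U - U * Y) ⊗ₖ V)).trace := by
  rw [commFst, sub_mul, trace_sub, mul_assoc, mul_assoc, trace_mul_comm (Y ⊗ₖ 1), mul_assoc,
    ← mul_kronecker_mul, ← mul_kronecker_mul, one_mul, mul_one, ← trace_sub, ← mul_sub]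
  congr 2
  ext
  simp [sub_mul]

theorem trace_commSnd_mul_kronecker (R : Matrix (ι × ι) (ι × ι) ℂ) (Y U V : Matrix ι ι ℂ) :
    (commSnd R Y * (U ⊗ₖ V)).trace = (R * (U ⊗ₖ (Y * V - V * Y))).trace := by
  rw [commSnd, sub_mul, trace_sub, mul_assoc, mul_assoc, trace_mul_comm (1 ⊗ₖ Y), mul_assoc,
    ← mul_kronecker_mul, ← mul_kronecker_mul, one_mul, mul_one, ← trace_sub, ← mul_sub]
  congr 2
  ext
  simp [mul_sub]

theorem trace_commFst_mul_kronecker_of_commute (R : Matrix (ι × ι) (ι × ι) ℂ)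
    {Y U : Matrix ι ι ℂ} (h : Commute U Y) (V : Matrix ι ι ℂ) :
    (commFst R Y * (U ⊗ₖ V)).trace = 0 := by
  rw [trace_commFst_mul_kronecker, h.eq, sub_self, zero_kronecker, mul_zero, trace_zero]

theorem trace_commSnd_mul_kronecker_of_commute (R : Matrix (ι × ι) (ι × ι) ℂ)
    {Y V : Matrix ι ι ℂ} (h : Commute V Y) (U : Matrix ι ι ℂ) :
    (commSnd R Y * (U ⊗ₖ V)).trace = 0 := by
  rw [trace_commSnd_mul_kronecker, h.eq, sub_self, kronecker_zero, mul_zero, trace_zero]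

end Matrix

/-! ### Limits at a zero of the twist function -/

/-- A line is closed, so the limit stays on it, and uniqueness of limits makes it the same for all
`p`. The scalar limit, which would be a derivative of the twist function, need not be identified. -/
theorem exists_eq_smul_of_tendsto {α P E : Type*} {l : Filter α} [l.NeBot] [AddCommGroup E]
    [Module ℂ E] [TopologicalSpace E] [T2Space E] [IsTopologicalAddGroup E] [ContinuousSMul ℂ E]
    {c : α → ℂ} {v : E} {D : P → E} (h : ∀ p, Tendsto (fun a => c a • v) l (𝓝 (D p))) :
    ∃ c₀ : ℂ, ∀ p, D p = c₀ • v := by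
  rcases isEmpty_or_nonempty P with hP | ⟨⟨p₀⟩⟩
  · exact ⟨0, fun p => hP.elim p⟩
  · have hcl : IsClosed (Submodule.span ℂ {v} : Set E) :=
      Submodule.closed_of_finiteDimensional (Submodule.span ℂ {v})
    have hm : D p₀ ∈ (Submodule.span ℂ {v} : Set E) := hcl.mem_of_tendsto (h p₀)
      (Eventually.of_forall fun a => Submodule.smul_mem _ _ (Submodule.mem_span_singleton_self v))
    obtain ⟨c₀, hc₀⟩ := Submodule.mem_span_singleton.1 hm
    exact ⟨c₀, fun p => (tendsto_nhds_unique (h p) (h p₀)).trans hc₀.symm⟩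

theorem RatFunc.finite_setOf_eval_eq_zero {φ : RatFunc ℂ} (hφ : φ ≠ 0) :
    {z : ℂ | φ.eval (RingHom.id ℂ) z = 0}.Finite := by
  have h1 : {z : ℂ | φ.num.eval z = 0}.Finite :=
    (φ.num.rootSet_finite ℂ).subset fun z hz => by
      rw [Polynomial.mem_rootSet]; exact ⟨RatFunc.num_ne_zero hφ, by simpa using hz⟩
  have h2 : {z : ℂ | φ.denom.eval z = 0}.Finite :=
    (φ.denom.rootSet_finite ℂ).subset fun z hz => by
      rw [Polynomial.mem_rootSet]; exact ⟨RatFunc.denom_ne_zero φ, by simpa using hz⟩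
  refine (h1.union h2).subset fun z hz => ?_
  have hz' : φ.num.eval z / φ.denom.eval z = 0 := by
    simpa [RatFunc.eval, Polynomial.eval₂_eq_eval_map] using hz
  exact div_eq_zero_iff.1 hz'

/-- Numerator and denominator are coprime, so a zero of the numerator is not a pole. -/
theorem RatFunc.tendsto_eval_of_num_eq_zero {φ : RatFunc ℂ} {z₀ : ℂ} (h : φ.num.eval z₀ = 0) :
    Tendsto (fun z => φ.eval (RingHom.id ℂ) z) (𝓝 z₀) (𝓝 0) := by
  have hd : φ.denom.eval z₀ ≠ 0 := by
    intro hd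
    obtain ⟨a, b, hab⟩ := RatFunc.isCoprime_num_denom φ
    have := congrArg (Polynomial.eval z₀) hab
    simp [h, hd] at this
  have he : (fun z => φ.eval (RingHom.id ℂ) z) = fun z => φ.num.eval z / φ.denom.eval z := by
    funext z; simp [RatFunc.eval, Polynomial.eval₂_eq_eval_map]
  have ht : Tendsto (fun z => φ.num.eval z / φ.denom.eval z) (𝓝 z₀)
      (𝓝 (φ.num.eval z₀ / φ.denom.eval z₀)) :=
    (φ.num.continuous.tendsto z₀).div (φ.denom.continuous.tendsto z₀) hd
  rw [h, zero_div] at ht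
  rwa [he]

theorem Set.Finite.eventually_nhdsNE_notMem {s : Set ℂ} (hs : s.Finite) (z : ℂ) :
    ∀ᶠ w in 𝓝[≠] z, w ∉ s :=
  nhdsNE_le_cofinite z hs.compl_mem_cofinite

namespace FieldTheory

variable {M ι : Type*} [Fintype ι] [DecidableEq ι] (F : FieldTheory M)

/-- The value at `(p, x)` of the coefficient of `∂_x^q δ_xy` in `{Y₁(x), Z₂(y)}`. -/
def brMatrix (q : ℕ) (p : M) (x : ℝ) (Y Z : Matrix ι ι F.obs) : Matrix (ι × ι) (ι × ι) ℂ :=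
  Matrix.of fun a b => F.evalAt p x ((F.br (Y a.1 b.1) (Z a.2 b.2)).coeff q)

variable {F} {q : ℕ} {p : M} {x : ℝ}

theorem brMatrix_smul_left (a : ℂ) (Y Z : Matrix ι ι F.obs) :
    F.brMatrix q p x (a • Y) Z = a • F.brMatrix q p x Y Z := by
  ext; simp [brMatrix]

theorem brMatrix_smul_right (a : ℂ) (Y Z : Matrix ι ι F.obs) :
    F.brMatrix q p x Y (a • Z) = a • F.brMatrix q p x Y Z := by
  ext; simp [brMatrix]

theorem brMatrix_add_left (Y Y' Z : Matrix ι ι F.obs) :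
    F.brMatrix q p x (Y + Y') Z = F.brMatrix q p x Y Z + F.brMatrix q p x Y' Z := by
  ext; simp [brMatrix]

theorem brMatrix_sub_left (Y Y' Z : Matrix ι ι F.obs) :
    F.brMatrix q p x (Y - Y') Z = F.brMatrix q p x Y Z - F.brMatrix q p x Y' Z := by
  have h : Y - Y' = Y + (-1 : ℂ) • Y' := by ext; simp [sub_eq_add_neg]
  rw [h, brMatrix_add_left, brMatrix_smul_left, neg_one_smul, sub_eq_add_neg]

theorem brMatrix_sub_right (Y Z Z' : Matrix ι ι F.obs) :
    F.brMatrix q p x Y (Z - Z') = F.brMatrix q p x Y Z - F.brMatrix q p x Y Z' := by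
  ext; simp [brMatrix]

theorem tendsto_map_evalAt {α : Type*} {l : Filter α} {Y : α → Matrix ι ι F.obs}
    {Y₀ : Matrix ι ι F.obs} (h : ∀ i j, Tendsto (fun a => Y a i j) l (𝓝 (Y₀ i j))) :
    Tendsto (fun a => (Y a).map (F.evalAt p x)) l (𝓝 (Y₀.map (F.evalAt p x))) :=
  tendsto_pi_nhds.2 fun i => tendsto_pi_nhds.2 fun j =>
    ((F.continuous_evalAt p x).tendsto _).comp (h i j)

theorem tendsto_brMatrix_left {α : Type*} {l : Filter α} {Y : α → Matrix ι ι F.obs}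
    {Y₀ : Matrix ι ι F.obs} (h : ∀ i j, Tendsto (fun a => Y a i j) l (𝓝 (Y₀ i j)))
    (Z : Matrix ι ι F.obs) :
    Tendsto (fun a => F.brMatrix q p x (Y a) Z) l (𝓝 (F.brMatrix q p x Y₀ Z)) :=
  tendsto_pi_nhds.2 fun a => tendsto_pi_nhds.2 fun b =>
    (((F.continuous_evalAt p x).comp (F.continuous_br_left (Z a.2 b.2) q)).tendsto _).comp (h _ _)

theorem tendsto_brMatrix_right {α : Type*} {l : Filter α} {Z : α → Matrix ι ι F.obs}
    {Z₀ : Matrix ι ι F.obs} (Y : Matrix ι ι F.obs)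
    (h : ∀ i j, Tendsto (fun a => Z a i j) l (𝓝 (Z₀ i j))) :
    Tendsto (fun a => F.brMatrix q p x Y (Z a)) l (𝓝 (F.brMatrix q p x Y Z₀)) :=
  tendsto_pi_nhds.2 fun a => tendsto_pi_nhds.2 fun b =>
    (((F.continuous_evalAt p x).comp (F.continuous_br_right (Y a.1 b.1) q)).tendsto _).comp (h _ _)

end FieldTheory

/-! ### The Casimir tensor and the notion of a current -/

namespace LaxData

variable {M ι : Type*} [Fintype ι] [DecidableEq ι] {F : FieldTheory M}
  {𝔤 : LieSubalgebra ℂ (Matrix ι ι ℂ)} (S : LaxData F 𝔤)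

/-- The tensor `σᵏ₂ C₁₂`, with the tensor factors of `σᵏ₁ C₁₂` exchanged. -/
def casimirSwap (k : ℕ) : Matrix (ι × ι) (ι × ι) ℂ :=
  ∑ a : S.κ, (S.dual a : Matrix ι ι ℂ) ⊗ₖ (S.σ^[k] (S.basis a) : Matrix ι ι ℂ)

theorem casimir_submatrix_swap (k : ℕ) :
    (S.casimir k).submatrix Prod.swap Prod.swap = S.casimirSwap k := by
  ext a b
  simp [casimir, casimirSwap, Matrix.sum_apply, mul_comm]

/-- `R⁰₁₂(z, w)` with the tensor factors exchanged. -/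
def R0Swap (z w : ℂ) : Matrix (ι × ι) (ι × ι) ℂ :=
  (S.T : ℂ)⁻¹ • ∑ k ∈ Finset.range S.T, (w - (S.ω ^ k)⁻¹ * z)⁻¹ • S.casimirSwap k

theorem R0_submatrix_swap (z w : ℂ) :
    (S.R0 z w).submatrix Prod.swap Prod.swap = S.R0Swap z w := by
  simp only [R0Swap, ← casimir_submatrix_swap, R0]
  ext a b
  simp [Matrix.sum_apply]

/-- The orthogonal projection of matrices to `𝔤`. -/
def proj (U : Matrix ι ι ℂ) : Matrix ι ι ℂ :=
  ∑ a : S.κ, ((S.dual a : Matrix ι ι ℂ) * U).trace • (S.basis a : Matrix ι ι ℂ)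

theorem trace_casimirSwap_mul_kronecker (U V : Matrix ι ι ℂ) :
    (S.casimirSwap 0 * (U ⊗ₖ V)).trace = (S.proj U * V).trace := by
  simp [casimirSwap, proj, Finset.sum_mul, Matrix.trace_sum, ← Matrix.mul_kronecker_mul,
    Matrix.trace_kronecker]

theorem proj_of_mem {U : Matrix ι ι ℂ} (hU : U ∈ 𝔤) : S.proj U = U := by
  have h : U = ∑ a, S.basis.repr ⟨U, hU⟩ a • (S.basis a : Matrix ι ι ℂ) := by
    have := congrArg 𝔤.toSubmodule.subtype (S.basis.sum_repr ⟨U, hU⟩)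
    rw [map_sum] at this
    exact this.symm
  have h2 : ∀ b, ((S.dual b : Matrix ι ι ℂ) * U).trace = S.basis.repr ⟨U, hU⟩ b := by
    intro b
    conv_lhs => rw [h]
    simp only [Finset.mul_sum, mul_smul_comm, Matrix.trace_sum, Matrix.trace_smul,
      Matrix.trace_mul_comm (S.dual b : Matrix ι ι ℂ), S.trace_basis_dual]
    simp
  conv_rhs => rw [h]
  simp only [proj, h2]

/-- The trace is `Tr(proj U · [Y, V])`, which vanishes by cyclicity for every `Y`. It removes the
polar part of the `δ` coefficient before any limit is taken. -/
theorem trace_commSnd_casimirSwap_mul {U V : Matrix ι ι ℂ} (h : Commute (S.proj U) V)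
    (Y : Matrix ι ι ℂ) : (Matrix.commSnd (S.casimirSwap 0) Y * (U ⊗ₖ V)).trace = 0 := by
  rw [Matrix.trace_commSnd_mul_kronecker, trace_casimirSwap_mul_kronecker, mul_sub,
    Matrix.trace_sub, ← mul_assoc, ← mul_assoc, h.eq, Matrix.trace_mul_comm, ← mul_assoc, sub_self]

/-- The Poisson bracket of a field `J` with itself has a Kac-Moody type form, up to a coefficient
of `δ_xy` that does not contribute to brackets of invariant polynomials in `J`. -/
def IsCurrent (J : Matrix ι ι F.obs) : Prop :=
  ∃ c : ℂ, ∀ p x, (∀ q, 2 ≤ q → F.brMatrix q p x J J = 0) ∧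
    F.brMatrix 1 p x J J = c • S.casimirSwap 0 ∧
    ∀ U V : Matrix ι ι ℂ, Commute U (J.map (F.evalAt p x)) → Commute V (J.map (F.evalAt p x)) →
      Commute (S.proj U) V → (F.brMatrix 0 p x J J * (U ⊗ₖ V)).trace = 0

end LaxData

/-! ### Regular zeros at finite points -/

namespace RSSystem

variable {M ι : Type*} [Fintype ι] [DecidableEq ι] {F : FieldTheory M}
  {𝔤 : LieSubalgebra ℂ (Matrix ι ι ℂ)} (S : RSSystem F 𝔤) {p : M} {x : ℝ}

theorem mailletDelta_map_evalAt (z w : ℂ) (p : M) (x : ℝ) :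
    (S.mailletDelta z w).map (F.evalAt p x) =
      Matrix.commFst (S.R₁₂ z w) ((S.L z).map (F.evalAt p x)) -
        Matrix.commSnd (S.R₂₁ w z) ((S.L w).map (F.evalAt p x)) := by
  have h1 : ∀ R : Matrix (ι × ι) (ι × ι) ℂ,
      (F.evalAt p x : F.obs →+* ℂ).mapMatrix (R.map (algebraMap ℂ F.obs)) = R := by
    intro R; ext a b
    simp only [RingHom.mapMatrix_apply, Matrix.map_apply]
    exact (F.evalAt p x).commutes _
  have h2 : ∀ A B : Matrix ι ι F.obs, (F.evalAt p x : F.obs →+* ℂ).mapMatrix (A ⊗ₖ B) =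
      A.map (F.evalAt p x) ⊗ₖ B.map (F.evalAt p x) := by
    intro A B; ext a b; exact map_mul (F.evalAt p x) _ _
  have h3 : (1 : Matrix ι ι F.obs).map (F.evalAt p x) = 1 :=
    (F.evalAt p x : F.obs →+* ℂ).mapMatrix.map_one
  change (F.evalAt p x : F.obs →+* ℂ).mapMatrix (S.mailletDelta z w) = _
  simp only [LaxData.mailletDelta, map_sub, map_mul, h1, h2, h3, Matrix.commFst, Matrix.commSnd]

section Maillet

variable {z w : ℂ} (hz : z ∈ S.dom) (hw : w ∈ S.dom) (hz0 : S.twist z ≠ 0) (hw0 : S.twist w ≠ 0)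
  (hzw : z ^ S.T ≠ w ^ S.T)

include hz hw hz0 hw0 hzw

/-- The factors `φ(z)` and `φ(w)` cancel the `φ⁻¹` in `R₁₂` and `R₂₁`, leaving the kernel `R⁰`,
which does not involve the twist function. -/
theorem brMatrix_zero_twist_smul :
    F.brMatrix 0 p x (S.twist z • S.L z) (S.twist w • S.L w) =
      Matrix.commFst (S.R0 z w) ((S.twist z • S.L z).map (F.evalAt p x)) -
        Matrix.commSnd (S.R0Swap w z) ((S.twist w • S.L w).map (F.evalAt p x)) := by
  have hm : ∀ (c : ℂ) (Y : Matrix ι ι F.obs),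
      (c • Y).map (F.evalAt p x) = c • Y.map (F.evalAt p x) := by
    intro c Y; ext i j; exact map_smul (F.evalAt p x) c _
  have h : F.brMatrix 0 p x (S.L z) (S.L w) = (S.mailletDelta z w).map (F.evalAt p x) := by
    ext a b
    simp only [FieldTheory.brMatrix, Matrix.of_apply, S.maillet z hz w hw hz0 hw0 hzw]
    simp
  rw [FieldTheory.brMatrix_smul_left, FieldTheory.brMatrix_smul_right, h, mailletDelta_map_evalAt,
    hm, hm, Matrix.commFst_smul_right, Matrix.commSnd_smul_right, LaxData.R₂₁, LaxData.R₁₂,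
    LaxData.R₁₂, Matrix.submatrix_smul, Pi.smul_apply, Pi.smul_apply, LaxData.R0_submatrix_swap,
    Matrix.commFst_smul_left, Matrix.commSnd_smul_left, smul_sub, smul_sub, smul_smul, smul_smul,
    smul_smul, smul_smul]
  congr 2
  · field_simp
  · field_simp

theorem brMatrix_one_twist_smul :
    F.brMatrix 1 p x (S.twist z • S.L z) (S.twist w • S.L w) =
      -(S.twist z • S.R0 z w + S.twist w • S.R0Swap w z) := by
  have h : F.brMatrix 1 p x (S.L z) (S.L w) = -(S.R₁₂ z w + S.R₂₁ w z) := by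
    ext a b
    simp only [FieldTheory.brMatrix, Matrix.of_apply, S.maillet z hz w hw hz0 hw0 hzw]
    simp only [coeff_add, coeff_C_succ, coeff_C_mul, coeff_X_one, mul_one, zero_add]
    exact (F.evalAt p x).commutes _
  rw [FieldTheory.brMatrix_smul_left, FieldTheory.brMatrix_smul_right, h, LaxData.R₂₁, LaxData.R₁₂,
    LaxData.R₁₂, Matrix.submatrix_smul, Pi.smul_apply, Pi.smul_apply, LaxData.R0_submatrix_swap,
    smul_neg, smul_neg, smul_add, smul_add, smul_smul, smul_smul, smul_smul, smul_smul]
  congr 3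
  · field_simp
  · field_simp

theorem brMatrix_twist_smul_of_two_le {q : ℕ} (hq : 2 ≤ q) :
    F.brMatrix q p x (S.twist z • S.L z) (S.twist w • S.L w) = 0 := by
  have h : F.brMatrix q p x (S.L z) (S.L w) = 0 := by
    ext a b
    simp only [FieldTheory.brMatrix, Matrix.of_apply, S.maillet z hz w hw hz0 hw0 hzw]
    rw [coeff_add, coeff_C_of_ne_zero (by omega), coeff_C_mul, coeff_X_of_ne_one (by omega)]
    simp
  rw [FieldTheory.brMatrix_smul_left, FieldTheory.brMatrix_smul_right, h, smul_zero, smul_zero]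

end Maillet

theorem finite_setOf_twist_eq_zero : {z : ℂ | S.twist z = 0}.Finite :=
  RatFunc.finite_setOf_eval_eq_zero S.φ_ne_zero

theorem finite_setOf_pow_eq (c : ℂ) : {z : ℂ | z ^ S.T = c}.Finite := by
  have hne : (X ^ S.T - C c : ℂ[X]) ≠ 0 := X_pow_sub_C_ne_zero S.T_pos c
  refine ((X ^ S.T - C c : ℂ[X]).rootSet_finite ℂ).subset fun z hz => ?_
  rw [mem_rootSet]
  exact ⟨hne, by simpa [sub_eq_zero] using hz⟩

end RSSystem

theorem Matrix.commSnd_add_left {ι : Type*} [Fintype ι] [DecidableEq ι]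
    (R R' : Matrix (ι × ι) (ι × ι) ℂ) (Y : Matrix ι ι ℂ) :
    commSnd (R + R') Y = commSnd R Y + commSnd R' Y := by
  simp only [commSnd, add_mul, mul_add]
  abel

namespace RSSystem

variable {M ι : Type*} [Fintype ι] [DecidableEq ι] {F : FieldTheory M}
  {𝔤 : LieSubalgebra ℂ (Matrix ι ι ℂ)} (S : RSSystem F 𝔤) {p : M} {x : ℝ}

theorem sub_inv_pow_mul_ne_zero {a b : ℂ} (h : a ^ S.T ≠ b ^ S.T) (k : ℕ) :
    a - (S.ω ^ k)⁻¹ * b ≠ 0 := by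
  intro h0
  refine h ?_
  rw [sub_eq_zero.1 h0, mul_pow, inv_pow, ← pow_mul, mul_comm k, pow_mul, S.ω_prim.pow_eq_one,
    one_pow, inv_one, one_mul]

theorem tendsto_R0_left {z₀ w : ℂ} (h : w ^ S.T ≠ z₀ ^ S.T) :
    Tendsto (fun z => S.R0 z w) (𝓝 z₀) (𝓝 (S.R0 z₀ w)) := by
  refine Tendsto.const_smul (tendsto_finsetSum _ fun k _ => Tendsto.smul_const ?_ _) _
  exact Tendsto.inv₀ (tendsto_const_nhds.sub (tendsto_id.const_mul _))
    (S.sub_inv_pow_mul_ne_zero h k)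

theorem tendsto_R0Swap_right {z₀ w : ℂ} (h : z₀ ^ S.T ≠ w ^ S.T) :
    Tendsto (fun z => S.R0Swap w z) (𝓝 z₀) (𝓝 (S.R0Swap w z₀)) := by
  refine Tendsto.const_smul (tendsto_finsetSum _ fun k _ => Tendsto.smul_const ?_ _) _
  exact Tendsto.inv₀ (tendsto_id.sub tendsto_const_nhds) (S.sub_inv_pow_mul_ne_zero h k)

/-- The part of `T R⁰₂₁(w, z)` that is regular at `w = z`. -/
def R0SwapRegular (w z : ℂ) : Matrix (ι × ι) (ι × ι) ℂ :=
  ∑ k ∈ Finset.Ico 1 S.T, (z - (S.ω ^ k)⁻¹ * w)⁻¹ • S.casimirSwap k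

/-- Away from cyclotomic points only the summand `k = 0` is singular at `w = z`. -/
theorem R0Swap_eq (w z : ℂ) : S.R0Swap w z =
    (S.T : ℂ)⁻¹ • ((z - w)⁻¹ • S.casimirSwap 0 + S.R0SwapRegular w z) := by
  rw [LaxData.R0Swap, Finset.range_eq_Ico, Finset.sum_eq_sum_Ico_succ_bot S.T_pos]
  simp [R0SwapRegular]

/-- For `0 < k < T` the denominator tends to `(1 - ω⁻ᵏ) z₀`, which is nonzero exactly because the
point is non-cyclotomic. -/
theorem tendsto_R0SwapRegular {z₀ : ℂ} (h : S.T = 1 ∨ z₀ ≠ 0) :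
    Tendsto (fun w => S.R0SwapRegular w z₀) (𝓝 z₀) (𝓝 (S.R0SwapRegular z₀ z₀)) := by
  refine tendsto_finsetSum _ fun k hk => Tendsto.smul_const ?_ _
  rw [Finset.mem_Ico] at hk
  refine Tendsto.inv₀ (tendsto_const_nhds.sub (tendsto_id.const_mul _)) ?_
  have hz : z₀ ≠ 0 := h.resolve_left (by omega)
  have hω : S.ω ^ k ≠ 1 := S.ω_prim.pow_ne_one_of_pos_of_lt (by omega) hk.2
  intro h0
  have h1 : (1 - (S.ω ^ k)⁻¹) * z₀ = 0 := by rw [sub_mul, one_mul]; exact h0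
  have h2 := (mul_eq_zero.1 h1).resolve_right hz
  exact hω (inv_eq_one.1 (sub_eq_zero.1 h2).symm)

variable {S} {z₀ : ℂ} {J : Matrix ι ι F.obs}

/-- The limit `z → z₀` at fixed `w`. The two limits are taken successively because the bracket is
only assumed continuous in each argument. In the `δ'` coefficient `φ(z) → 0` removes `R⁰₁₂`. -/
theorem IsFiniteRegularZero.brMatrix_twist_smul (h : S.IsFiniteRegularZero z₀ J) {w : ℂ}
    (hw : w ∈ S.dom) (hw0 : S.twist w ≠ 0) (hwz : z₀ ^ S.T ≠ w ^ S.T) (p : M) (x : ℝ) :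
    F.brMatrix 0 p x J (S.twist w • S.L w) =
        Matrix.commFst (S.R0 z₀ w) (J.map (F.evalAt p x)) -
          Matrix.commSnd (S.R0Swap w z₀) ((S.twist w • S.L w).map (F.evalAt p x)) ∧
      F.brMatrix 1 p x J (S.twist w • S.L w) = -(S.twist w • S.R0Swap w z₀) ∧
      ∀ q, 2 ≤ q → F.brMatrix q p x J (S.twist w • S.L w) = 0 := by
  obtain ⟨hnum, hdom, hX⟩ := h
  have hX' : ∀ i j, Tendsto (fun z => (S.twist z • S.L z) i j) (𝓝[≠] z₀) (𝓝 (J i j)) := hX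
  have hev : ∀ᶠ z in 𝓝[≠] z₀, z ∈ S.dom ∧ S.twist z ≠ 0 ∧ z ^ S.T ≠ w ^ S.T := by
    filter_upwards [hdom, S.finite_setOf_twist_eq_zero.eventually_nhdsNE_notMem z₀,
      (S.finite_setOf_pow_eq (w ^ S.T)).eventually_nhdsNE_notMem z₀] with z h1 h2 h3
    exact ⟨h1, h2, h3⟩
  have hφ : Tendsto S.twist (𝓝[≠] z₀) (𝓝 0) :=
    (RatFunc.tendsto_eval_of_num_eq_zero hnum).mono_left nhdsWithin_le_nhds
  have hR := (S.tendsto_R0_left hwz.symm).mono_left (nhdsWithin_le_nhds (s := {z₀}ᶜ))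
  have hRs := (S.tendsto_R0Swap_right hwz).mono_left (nhdsWithin_le_nhds (s := {z₀}ᶜ))
  refine ⟨?_, ?_, fun q hq => ?_⟩
  · refine tendsto_nhds_unique (FieldTheory.tendsto_brMatrix_left hX' _) ?_
    refine Tendsto.congr' (hev.mono fun z hz =>
      (S.brMatrix_zero_twist_smul hz.1 hw hz.2.1 hw0 hz.2.2).symm) ?_
    exact (Matrix.tendsto_commFst hR (FieldTheory.tendsto_map_evalAt hX')).sub
      (Matrix.tendsto_commSnd hRs tendsto_const_nhds)
  · refine tendsto_nhds_unique (FieldTheory.tendsto_brMatrix_left hX' _) ?_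
    refine Tendsto.congr' (hev.mono fun z hz =>
      (S.brMatrix_one_twist_smul hz.1 hw hz.2.1 hw0 hz.2.2).symm) ?_
    simpa using ((hφ.smul hR).add (hRs.const_smul (S.twist w))).neg
  · refine tendsto_nhds_unique (FieldTheory.tendsto_brMatrix_left hX' _) ?_
    exact Tendsto.congr' (hev.mono fun z hz =>
      (S.brMatrix_twist_smul_of_two_le hz.1 hw hz.2.1 hw0 hz.2.2 hq).symm) tendsto_const_nhds

/-- The limit `w → z₀`. In the `δ'` coefficient `φ(w) → 0` kills the regular part of `R⁰₂₁`, and the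
polar part is a scalar times `C₂₁`. In the `δ` coefficient the polar part pairs to zero with `U ⊗
V`, and the regular part tends to a commutator with `J₂`, invisible to `V`. -/
theorem IsFiniteRegularZero.isCurrent (h : S.IsFiniteRegularZero z₀ J) (hz : S.T = 1 ∨ z₀ ≠ 0) :
    S.IsCurrent J := by
  have hX : ∀ i j, Tendsto (fun w => (S.twist w • S.L w) i j) (𝓝[≠] z₀) (𝓝 (J i j)) := h.2.2
  have hev : ∀ᶠ w in 𝓝[≠] z₀, w ∈ S.dom ∧ S.twist w ≠ 0 ∧ z₀ ^ S.T ≠ w ^ S.T := by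
    filter_upwards [h.2.1, S.finite_setOf_twist_eq_zero.eventually_nhdsNE_notMem z₀,
      (S.finite_setOf_pow_eq (z₀ ^ S.T)).eventually_nhdsNE_notMem z₀] with z h1 h2 h3
    exact ⟨h1, h2, fun h4 => h3 h4.symm⟩
  have hφ : Tendsto S.twist (𝓝[≠] z₀) (𝓝 0) :=
    (RatFunc.tendsto_eval_of_num_eq_zero h.1).mono_left nhdsWithin_le_nhds
  have hR := (S.tendsto_R0SwapRegular hz).mono_left (nhdsWithin_le_nhds (s := {z₀}ᶜ))
  -- The scalar does not depend on the configuration or on the point, hence neither does its limit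
  -- `c`.
  have h1 : ∀ px : M × ℝ, Tendsto
      (fun w => (-(S.twist w * (S.T : ℂ)⁻¹ * (z₀ - w)⁻¹)) • S.casimirSwap 0) (𝓝[≠] z₀)
      (𝓝 (F.brMatrix 1 px.1 px.2 J J)) := by
    intro px
    have h2 := (FieldTheory.tendsto_brMatrix_right (q := 1) (p := px.1) (x := px.2) J hX).add
      ((hφ.mul_const (S.T : ℂ)⁻¹).smul hR)
    rw [zero_mul, zero_smul, add_zero] at h2
    refine h2.congr' (hev.mono fun w hw => ?_)
    rw [(h.brMatrix_twist_smul hw.1 hw.2.1 hw.2.2 px.1 px.2).2.1, R0Swap_eq]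
    module
  obtain ⟨c, hc⟩ := exists_eq_smul_of_tendsto h1
  refine ⟨c, fun p x => ⟨fun q hq => ?_, hc (p, x), fun U V hU hV hUV => ?_⟩⟩
  · refine tendsto_nhds_unique (FieldTheory.tendsto_brMatrix_right J hX) ?_
    exact tendsto_const_nhds.congr' (hev.mono fun w hw =>
      ((h.brMatrix_twist_smul hw.1 hw.2.1 hw.2.2 p x).2.2 q hq).symm)
  · refine tendsto_nhds_unique
      (Matrix.tendsto_trace_mul (FieldTheory.tendsto_brMatrix_right J hX) (U ⊗ₖ V)) ?_
    have h3 := Matrix.tendsto_trace_mul (Matrix.tendsto_commSnd hR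
      (FieldTheory.tendsto_map_evalAt (p := p) (x := x) hX)) (U ⊗ₖ V)
    have h4 := h3.const_mul (-(S.T : ℂ)⁻¹)
    rw [Matrix.trace_commSnd_mul_kronecker_of_commute _ hV, mul_zero] at h4
    refine h4.congr' (hev.mono fun w hw => ?_)
    beta_reduce
    rw [(h.brMatrix_twist_smul hw.1 hw.2.1 hw.2.2 p x).1, R0Swap_eq, Matrix.commSnd_smul_left,
      Matrix.commSnd_add_left, Matrix.commSnd_smul_left, sub_mul, Matrix.trace_sub,
      Matrix.trace_commFst_mul_kronecker_of_commute _ hU, smul_mul_assoc, add_mul, smul_mul_assoc,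
      Matrix.trace_smul, Matrix.trace_add, Matrix.trace_smul, S.trace_commSnd_casimirSwap_mul hUV]
    simp

end RSSystem

/-! ### The regular zero at infinity -/

namespace RSSystem

variable {M ι : Type*} [Fintype ι] [DecidableEq ι] {F : FieldTheory M}
  {𝔤 : LieSubalgebra ℂ (Matrix ι ι ℂ)} (S : RSSystem F 𝔤) {p : M} {x : ℝ}

theorem R0_of_T_eq_one (hT : S.T = 1) (z w : ℂ) : S.R0 z w = (w - z)⁻¹ • S.casimir 0 := by
  simp [LaxData.R0, hT]

theorem R0Swap_of_T_eq_one (hT : S.T = 1) (z w : ℂ) :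
    S.R0Swap z w = (w - z)⁻¹ • S.casimirSwap 0 := by
  simp [LaxData.R0Swap, hT]

/-- The Lax matrix near infinity, `P(α) = α⁻¹ φ(1/α) ℒ(1/α)`. -/
def laxInfty (α : ℂ) : Matrix ι ι F.obs := (α⁻¹ * S.twist α⁻¹) • S.L α⁻¹

/-- `α` is a nonzero point where the Lax matrix and the twist function are well behaved at `1/α`. -/
def GoodInfty (α : ℂ) : Prop := α ≠ 0 ∧ α⁻¹ ∈ S.dom ∧ S.twist α⁻¹ ≠ 0

theorem laxInfty_eq (α : ℂ) : S.laxInfty α = α⁻¹ • (S.twist α⁻¹ • S.L α⁻¹) := by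
  rw [laxInfty, mul_smul]

variable {S}

/-- Expresses `J` as minus the derivative of `P` at `0`, so that its brackets come from difference
quotients of those of `P = laxInfty`. -/
theorem GoodInfty.twistInfty_smul_LInfty {α : ℂ} (hα : S.GoodInfty α) (K : Matrix ι ι F.obs) :
    S.twistInfty α • S.LInfty K α = (-α⁻¹) • (S.laxInfty α - K) := by
  obtain ⟨h0, -, h1⟩ := hα
  have h2 : S.twistInfty α * (α * (S.twist α⁻¹)⁻¹) = -α⁻¹ := by
    rw [twistInfty, mul_comm α, ← mul_assoc, mul_assoc _ (S.twist _), mul_inv_cancel₀ h1]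
    field_simp
  have h3 : S.twistInfty α = -α⁻¹ * (α⁻¹ * S.twist α⁻¹) := by
    rw [twistInfty]; ring
  rw [LInfty, smul_sub, smul_sub, smul_smul, h2, laxInfty, smul_smul, h3]

section

variable (hT : S.T = 1) {α β : ℂ} (hα : S.GoodInfty α) (hβ : S.GoodInfty β) (hαβ : α ≠ β)

include hT hα hβ hαβ

theorem brMatrix_zero_laxInfty : F.brMatrix 0 p x (S.laxInfty α) (S.laxInfty β) =
    (α - β)⁻¹ • (α • Matrix.commFst (S.casimir 0) ((S.laxInfty α).map (F.evalAt p x)) +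
      β • Matrix.commSnd (S.casimirSwap 0) ((S.laxInfty β).map (F.evalAt p x))) := by
  have hne : α⁻¹ ^ S.T ≠ β⁻¹ ^ S.T := by rw [hT]; simpa using hαβ
  have hm : ∀ (c : ℂ) (Y : Matrix ι ι F.obs),
      (c • Y).map (F.evalAt p x) = c • Y.map (F.evalAt p x) := by
    intro c Y; ext i j; exact map_smul (F.evalAt p x) c _
  have h0 := hα.1
  have h0' := hβ.1
  have h1 : α - β ≠ 0 := sub_ne_zero.2 hαβ
  have h2 : β⁻¹ - α⁻¹ = (α - β) * (α⁻¹ * β⁻¹) := by field_simp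
  have h2' : α⁻¹ - β⁻¹ = -((α - β) * (α⁻¹ * β⁻¹)) := by field_simp; ring
  rw [laxInfty_eq, laxInfty_eq, FieldTheory.brMatrix_smul_left, FieldTheory.brMatrix_smul_right,
    S.brMatrix_zero_twist_smul hα.2.1 hβ.2.1 hα.2.2 hβ.2.2 hne, R0_of_T_eq_one S hT,
    R0Swap_of_T_eq_one S hT, hm α⁻¹, hm β⁻¹, Matrix.commFst_smul_left, Matrix.commSnd_smul_left,
    Matrix.commFst_smul_right α⁻¹, Matrix.commSnd_smul_right β⁻¹, h2, h2']
  match_scalars <;> field_simp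

theorem brMatrix_one_laxInfty : F.brMatrix 1 p x (S.laxInfty α) (S.laxInfty β) =
    (α - β)⁻¹ • ((α ^ 2 * S.twistInfty α) • S.casimir 0 -
      (β ^ 2 * S.twistInfty β) • S.casimirSwap 0) := by
  have hne : α⁻¹ ^ S.T ≠ β⁻¹ ^ S.T := by rw [hT]; simpa using hαβ
  have h0 := hα.1
  have h0' := hβ.1
  have h1 : α - β ≠ 0 := sub_ne_zero.2 hαβ
  have h2 : β⁻¹ - α⁻¹ = (α - β) * (α⁻¹ * β⁻¹) := by field_simp
  have h2' : α⁻¹ - β⁻¹ = -((α - β) * (α⁻¹ * β⁻¹)) := by field_simp; ring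
  rw [laxInfty_eq, laxInfty_eq, FieldTheory.brMatrix_smul_left, FieldTheory.brMatrix_smul_right,
    S.brMatrix_one_twist_smul hα.2.1 hβ.2.1 hα.2.2 hβ.2.2 hne, R0_of_T_eq_one S hT,
    R0Swap_of_T_eq_one S hT, twistInfty, twistInfty, h2, h2']
  match_scalars <;> field_simp

theorem brMatrix_laxInfty_of_two_le {q : ℕ} (hq : 2 ≤ q) :
    F.brMatrix q p x (S.laxInfty α) (S.laxInfty β) = 0 := by
  have hne : α⁻¹ ^ S.T ≠ β⁻¹ ^ S.T := by rw [hT]; simpa using hαβ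
  rw [laxInfty_eq, laxInfty_eq, FieldTheory.brMatrix_smul_left, FieldTheory.brMatrix_smul_right,
    S.brMatrix_twist_smul_of_two_le hα.2.1 hβ.2.1 hα.2.2 hβ.2.2 hne hq, smul_zero, smul_zero]

end

theorem tendsto_inv_sub {β : ℂ} (hβ : β ≠ 0) :
    Tendsto (fun α : ℂ => (α - β)⁻¹) (𝓝[≠] 0) (𝓝 (-β⁻¹)) := by
  have h : Tendsto (fun α : ℂ => (α - β)⁻¹) (𝓝 0) (𝓝 (0 - β)⁻¹) :=
    (tendsto_id.sub tendsto_const_nhds).inv₀ (by simpa using hβ)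
  rw [zero_sub, inv_neg] at h
  exact h.mono_left nhdsWithin_le_nhds

section Limits

variable {J K : Matrix ι ι F.obs} (hT : S.T = 1)
  (hgood : ∀ᶠ α in 𝓝[≠] (0 : ℂ), S.GoodInfty α)
  (hψ : Tendsto S.twistInfty (𝓝[≠] 0) (𝓝 0))
  (hP : ∀ i j, Tendsto (fun α => S.laxInfty α i j) (𝓝[≠] 0) (𝓝 (K i j)))
  (hY : ∀ i j, Tendsto (fun α => ((-α⁻¹) • (S.laxInfty α - K)) i j) (𝓝[≠] 0) (𝓝 (J i j)))

include hT hgood hP hY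

theorem brMatrix_infty_of_two_le (p : M) (x : ℝ) {q : ℕ} (hq : 2 ≤ q) :
    F.brMatrix q p x J J = 0 := by
  have h1 : ∀ β, S.GoodInfty β → F.brMatrix q p x J (S.laxInfty β) = 0 := by
    intro β hβ
    have hev := hgood.and ((Set.finite_singleton β).eventually_nhdsNE_notMem 0)
    have hK : F.brMatrix q p x K (S.laxInfty β) = 0 :=
      tendsto_nhds_unique (FieldTheory.tendsto_brMatrix_left hP _)
        (tendsto_const_nhds.congr' (hev.mono fun α hα =>
          (brMatrix_laxInfty_of_two_le hT hα.1 hβ hα.2 hq).symm))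
    refine tendsto_nhds_unique (FieldTheory.tendsto_brMatrix_left hY _) ?_
    refine tendsto_const_nhds.congr' (hev.mono fun α hα => ?_)
    beta_reduce
    rw [FieldTheory.brMatrix_smul_left, FieldTheory.brMatrix_sub_left, hK,
      brMatrix_laxInfty_of_two_le hT hα.1 hβ hα.2 hq, sub_zero, smul_zero]
  have hK : F.brMatrix q p x J K = 0 :=
    tendsto_nhds_unique (FieldTheory.tendsto_brMatrix_right J hP)
      (tendsto_const_nhds.congr' (hgood.mono fun β hβ => (h1 β hβ).symm))
  refine tendsto_nhds_unique (FieldTheory.tendsto_brMatrix_right J hY) ?_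
  refine tendsto_const_nhds.congr' (hgood.mono fun β hβ => ?_)
  beta_reduce
  rw [FieldTheory.brMatrix_smul_right, FieldTheory.brMatrix_sub_right, hK, h1 β hβ, sub_zero,
    smul_zero]

-- With `K = P(0)`, sending `α → 0` gives `{K, P(β)}` and `{J, P(β)}` with `δ'` coefficients `β ψ(β)
-- C₂₁` and `-ψ(β) C₂₁`. The latter tends to `0`, so it does not contribute to `{J, K}`, and the
-- difference quotient in `β` gives the claim.
include hψ in
theorem tendsto_brMatrix_one_infty (p : M) (x : ℝ) :
    Tendsto (fun β => (β⁻¹ * S.twistInfty β) • S.casimirSwap 0) (𝓝[≠] 0)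
      (𝓝 (F.brMatrix 1 p x J J)) := by
  have hid : Tendsto (fun α : ℂ => α) (𝓝[≠] 0) (𝓝 0) := nhdsWithin_le_nhds
  have h1 : ∀ β, S.GoodInfty β →
      F.brMatrix 1 p x J (S.laxInfty β) = (-S.twistInfty β) • S.casimirSwap 0 := by
    intro β hβ
    have h0 := hβ.1
    have hev := hgood.and ((Set.finite_singleton β).eventually_nhdsNE_notMem 0)
    have hK : F.brMatrix 1 p x K (S.laxInfty β) = (β * S.twistInfty β) • S.casimirSwap 0 := by
      have h2 := (tendsto_inv_sub hβ.1).smul ((((hid.pow 2).mul hψ).smul_const (S.casimir 0)).sub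
        (tendsto_const_nhds (x := (β ^ 2 * S.twistInfty β) • S.casimirSwap 0)))
      refine (tendsto_nhds_unique (FieldTheory.tendsto_brMatrix_left hP _) (h2.congr'
        (hev.mono fun α hα => (brMatrix_one_laxInfty hT hα.1 hβ hα.2).symm))).trans ?_
      rw [mul_zero, zero_smul, zero_sub, smul_neg, smul_smul, ← neg_smul]
      congr 1
      field_simp
    refine tendsto_nhds_unique (FieldTheory.tendsto_brMatrix_left hY _) ?_
    have h3 := ((tendsto_inv_sub hβ.1).mul ((hid.mul hψ).neg)).smul_const (S.casimir 0)
    have h4 := ((tendsto_inv_sub hβ.1).mul_const (β * S.twistInfty β)).smul_const (S.casimirSwap 0)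
    have h5 := h3.add h4
    have e : (-β⁻¹ * -(0 * 0)) • S.casimir 0 + (-β⁻¹ * (β * S.twistInfty β)) • S.casimirSwap 0 =
        (-S.twistInfty β) • S.casimirSwap 0 := by
      rw [mul_zero, neg_zero, mul_zero, zero_smul, zero_add]
      congr 1
      field_simp
    rw [e] at h5
    refine h5.congr' (hev.mono fun α hα => ?_)
    have hα0 := hα.1.1
    have hαβ : α - β ≠ 0 := sub_ne_zero.2 hα.2
    beta_reduce
    rw [FieldTheory.brMatrix_smul_left, FieldTheory.brMatrix_sub_left, hK,
      brMatrix_one_laxInfty hT hα.1 hβ hα.2]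
    match_scalars
    · field_simp
    · field_simp
      ring
  have hK : F.brMatrix 1 p x J K = 0 := by
    have h2 := hψ.neg.smul_const (S.casimirSwap 0)
    rw [neg_zero, zero_smul] at h2
    exact tendsto_nhds_unique (FieldTheory.tendsto_brMatrix_right J hP)
      (h2.congr' (hgood.mono fun β hβ => (h1 β hβ).symm))
  refine (FieldTheory.tendsto_brMatrix_right J hY).congr' (hgood.mono fun β hβ => ?_)
  beta_reduce
  rw [FieldTheory.brMatrix_smul_right, FieldTheory.brMatrix_sub_right, hK, h1 β hβ, sub_zero,
    smul_smul, neg_mul_neg]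

/-- Here the commutator surviving the first limit is with `K`, not `J`, so commutation with `J` is
of no help. Finiteness of a limit is used instead: the pairing of `{J, P(β)}` is `β⁻¹ t`. -/
theorem trace_brMatrix_zero_infty (p : M) (x : ℝ) {U V : Matrix ι ι ℂ}
    (hUV : Commute (S.proj U) V) : (F.brMatrix 0 p x J J * (U ⊗ₖ V)).trace = 0 := by
  have hid : Tendsto (fun α : ℂ => α) (𝓝[≠] 0) (𝓝 0) := nhdsWithin_le_nhds
  set t := (Matrix.commFst (S.casimir 0) (K.map (F.evalAt p x)) * (U ⊗ₖ V)).trace with ht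
  have htr := Matrix.tendsto_trace_mul (Matrix.tendsto_commFst
    (tendsto_const_nhds (x := S.casimir 0))
    (FieldTheory.tendsto_map_evalAt (p := p) (x := x) hP)) (U ⊗ₖ V)
  have hbr : ∀ α β, S.GoodInfty α → S.GoodInfty β → α ≠ β →
      (F.brMatrix 0 p x (S.laxInfty α) (S.laxInfty β) * (U ⊗ₖ V)).trace =
      (α - β)⁻¹ * (α * (Matrix.commFst (S.casimir 0) ((S.laxInfty α).map (F.evalAt p x)) *
        (U ⊗ₖ V)).trace) := by
    intro α β hα hβ hαβ
    rw [brMatrix_zero_laxInfty hT hα hβ hαβ, smul_mul_assoc, add_mul, smul_mul_assoc,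
      smul_mul_assoc, Matrix.trace_smul, Matrix.trace_add, Matrix.trace_smul, Matrix.trace_smul,
      S.trace_commSnd_casimirSwap_mul hUV]
    simp
  have h1 : ∀ β, S.GoodInfty β →
      (F.brMatrix 0 p x J (S.laxInfty β) * (U ⊗ₖ V)).trace = β⁻¹ * t := by
    intro β hβ
    have hev := hgood.and ((Set.finite_singleton β).eventually_nhdsNE_notMem 0)
    have hK : (F.brMatrix 0 p x K (S.laxInfty β) * (U ⊗ₖ V)).trace = 0 := by
      have h2 := (tendsto_inv_sub hβ.1).mul (hid.mul htr)
      rw [zero_mul, mul_zero] at h2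
      exact tendsto_nhds_unique
        (Matrix.tendsto_trace_mul (FieldTheory.tendsto_brMatrix_left hP _) _)
        (h2.congr' (hev.mono fun α hα => (hbr α β hα.1 hβ hα.2).symm))
    have h2 := (tendsto_inv_sub hβ.1).neg.mul htr
    rw [neg_neg] at h2
    refine tendsto_nhds_unique
      (Matrix.tendsto_trace_mul (FieldTheory.tendsto_brMatrix_left hY _) _)
      (h2.congr' (hev.mono fun α hα => ?_))
    have hα0 := hα.1.1
    beta_reduce
    rw [FieldTheory.brMatrix_smul_left, FieldTheory.brMatrix_sub_left, smul_mul_assoc, sub_mul,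
      Matrix.trace_smul, Matrix.trace_sub, hK, hbr α β hα.1 hβ hα.2, smul_eq_mul]
    field_simp
    ring
  have hK := Matrix.tendsto_trace_mul
    (FieldTheory.tendsto_brMatrix_right (q := 0) (p := p) (x := x) J hP) (U ⊗ₖ V)
  -- `β⁻¹ t` converges as `β → 0`, to the pairing of `{J, K}`, which forces `t = 0`.
  have ht0 : t = 0 := by
    have h2 := hid.mul hK
    rw [zero_mul] at h2
    refine tendsto_nhds_unique (tendsto_const_nhds.congr' (hgood.mono fun β hβ => ?_)) h2
    rw [h1 β hβ, mul_inv_cancel_left₀ hβ.1]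
  have hK0 : (F.brMatrix 0 p x J K * (U ⊗ₖ V)).trace = 0 :=
    tendsto_nhds_unique hK (tendsto_const_nhds.congr' (hgood.mono fun β hβ => by
      beta_reduce
      rw [h1 β hβ, ht0, mul_zero]))
  refine tendsto_nhds_unique
    (Matrix.tendsto_trace_mul (FieldTheory.tendsto_brMatrix_right J hY) _)
    (tendsto_const_nhds.congr' (hgood.mono fun β hβ => ?_))
  beta_reduce
  rw [FieldTheory.brMatrix_smul_right, FieldTheory.brMatrix_sub_right, smul_mul_assoc, sub_mul,
    Matrix.trace_smul, Matrix.trace_sub, hK0, h1 β hβ, ht0, mul_zero, sub_zero, smul_zero]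

end Limits

theorem IsRegularZeroInfty.isCurrent {J : Matrix ι ι F.obs} (h : S.IsRegularZeroInfty J)
    (hT : S.T = 1) : S.IsCurrent J := by
  obtain ⟨hψ, hdom, K, hP, hY⟩ := h
  have hgood : ∀ᶠ α in 𝓝[≠] (0 : ℂ), S.GoodInfty α := by
    have hfin : {α : ℂ | S.twist α⁻¹ = 0}.Finite :=
      S.finite_setOf_twist_eq_zero.preimage (inv_injective.injOn)
    filter_upwards [hdom, hfin.eventually_nhdsNE_notMem 0, self_mem_nhdsWithin] with α h1 h2 h3
    exact ⟨h3, h1, h2⟩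
  have hY' : ∀ i j, Tendsto (fun α => ((-α⁻¹) • (S.laxInfty α - K)) i j) (𝓝[≠] 0)
      (𝓝 (J i j)) := fun i j => (hY i j).congr' (hgood.mono fun α hα =>
    congrFun (congrFun (hα.twistInfty_smul_LInfty K) i) j)
  obtain ⟨c, hc⟩ := exists_eq_smul_of_tendsto
    (fun px : M × ℝ => tendsto_brMatrix_one_infty hT hgood hψ hP hY' px.1 px.2)
  exact ⟨c, fun p x => ⟨fun q hq => brMatrix_infty_of_two_le hT hgood hP hY' p x hq, hc (p, x),
    fun U V _ _ hUV => trace_brMatrix_zero_infty hT hgood hP hY' p x hUV⟩⟩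

theorem IsRegularZero.isCurrent {z₀ : OnePoint ℂ} {J : Matrix ι ι F.obs}
    (h : S.IsRegularZero z₀ J) (hcyc : S.NonCyclotomic z₀) : S.IsCurrent J := by
  induction z₀ using OnePoint.rec with
  | infty =>
    exact IsRegularZeroInfty.isCurrent h (hcyc.resolve_right fun h => h.2 rfl)
  | coe z =>
    exact IsFiniteRegularZero.isCurrent h (hcyc.imp_right fun h hz => h.1 (by rw [hz]))

/-- A subspace of a finite-dimensional space is closed. -/
theorem map_evalAt_mem_of_tendsto {α : Type*} {l : Filter α} [l.NeBot] {Y : α → Matrix ι ι F.obs}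
    {J : Matrix ι ι F.obs} (hY : ∀ i j, Tendsto (fun a => Y a i j) l (𝓝 (J i j))) (p : M) (x : ℝ)
    (hmem : ∀ᶠ a in l, (Y a).map (F.evalAt p x) ∈ 𝔤) : J.map (F.evalAt p x) ∈ 𝔤 := by
  have hcl : IsClosed (𝔤.toSubmodule : Set (Matrix ι ι ℂ)) :=
    Submodule.closed_of_finiteDimensional _
  exact hcl.mem_of_tendsto (FieldTheory.tendsto_map_evalAt (p := p) (x := x) hY) hmem

theorem IsRegularZero.map_evalAt_mem {z₀ : OnePoint ℂ} {J : Matrix ι ι F.obs}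
    (h : S.IsRegularZero z₀ J) (p : M) (x : ℝ) : J.map (F.evalAt p x) ∈ 𝔤 := by
  have hm : ∀ (c : ℂ) (Y : Matrix ι ι F.obs),
      (c • Y).map (F.evalAt p x) = c • Y.map (F.evalAt p x) := by
    intro c Y; ext i j; exact map_smul (F.evalAt p x) c _
  have hL : ∀ z, (S.L z).map (F.evalAt p x) ∈ 𝔤 := fun z => (S.lax z p x).2
  induction z₀ using OnePoint.rec with
  | infty =>
    obtain ⟨-, -, K, hP, hY⟩ := h
    have hK : K.map (F.evalAt p x) ∈ 𝔤 := map_evalAt_mem_of_tendsto (Y := S.laxInfty) hP p x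
      (Eventually.of_forall fun α => by
        rw [laxInfty, hm]; exact 𝔤.smul_mem _ (hL _))
    refine map_evalAt_mem_of_tendsto (Y := fun α => S.twistInfty α • S.LInfty K α) hY p x
      (Eventually.of_forall fun α => ?_)
    have hs : ∀ Y Z : Matrix ι ι F.obs,
        (Y - Z).map (F.evalAt p x) = Y.map (F.evalAt p x) - Z.map (F.evalAt p x) := by
      intro Y Z; ext i j; exact map_sub (F.evalAt p x) _ _
    rw [hm, LInfty, hs, hm]
    exact 𝔤.smul_mem _ (𝔤.sub_mem (hL _) (𝔤.smul_mem _ hK))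
  | coe z =>
    refine map_evalAt_mem_of_tendsto (Y := fun w => S.twist w • S.L w) h.2.2 p x
      (Eventually.of_forall fun w => ?_)
    rw [hm]
    exact 𝔤.smul_mem _ (hL _)

end RSSystem

/-! ### From the current bracket to the commutation of charges -/

theorem Matrix.sum_mul_sum_eq_trace_kronecker {ι : Type*} [Fintype ι]
    (m : Matrix (ι × ι) (ι × ι) ℂ) (U V : Matrix ι ι ℂ) :
    ∑ c, ∑ d, V c d * ∑ a, ∑ b, U a b * m (b, d) (a, c) = (m * (U ⊗ₖ V)).trace := by
  rw [Matrix.trace_mul_comm]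
  simp only [Matrix.trace, Matrix.diag, Matrix.mul_apply, Matrix.kroneckerMap_apply,
    Fintype.sum_prod_type, Finset.mul_sum]
  rw [Finset.sum_comm (f := fun a c => ∑ b, ∑ d, U a b * V c d * m (b, d) (a, c))]
  refine Finset.sum_congr rfl fun c _ => ?_
  rw [Finset.sum_comm]
  refine Finset.sum_congr rfl fun a _ => ?_
  rw [Finset.sum_comm]
  exact Finset.sum_congr rfl fun b _ => Finset.sum_congr rfl fun d _ => by ring

namespace LaxData

variable {M ι : Type*} [Fintype ι] [DecidableEq ι] {F : FieldTheory M}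
  {𝔤 : LieSubalgebra ℂ (Matrix ι ι ℂ)} {S : LaxData F 𝔤}

/-- The bracket of the charges of two functions of a current `J`, with commuting gradients `U` and
`V`, has the density `c Tr (U ∂_x V)`. -/
theorem IsCurrent.exists_br_coeff_zero {J : Matrix ι ι F.obs} (hJ : S.IsCurrent J) :
    ∃ c : ℂ, ∀ {U V : Matrix ι ι F.obs} {f g : F.obs},
      (∀ D : Derivation ℂ F.obs F.obs, D f = (U * J.map D).trace) →
      (∀ D : Derivation ℂ F.obs F.obs, D g = (V * J.map D).trace) →
      Commute U J → Commute V J → Commute U V →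
      (∀ p x, U.map (F.evalAt p x) ∈ 𝔤) →
      (F.br f g).coeff 0 = c • (U * V.map F.dxDerivation).trace := by
  obtain ⟨c, hc⟩ := hJ
  refine ⟨c, fun {U V f g} hf hg hU hV hUV hmem => ?_⟩
  have hJ2 : ∀ i j k l q, 2 ≤ q → (F.br (J i j) (J k l)).coeff q = 0 := fun i j k l q hq =>
    FieldTheory.ext_evalAt fun p x => by
      rw [map_zero]
      exact congrFun (congrFun ((hc p x).1 q hq) (i, k)) (j, l)
  rw [FieldTheory.br_coeff_zero_of_gradient hf hg hJ2]
  refine FieldTheory.ext_evalAt fun p x => ?_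
  have hcomm : ∀ {Y Z : Matrix ι ι F.obs}, Commute Y Z →
      Commute (Y.map (F.evalAt p x)) (Z.map (F.evalAt p x)) := fun h =>
    h.map (F.evalAt p x : F.obs →+* ℂ).mapMatrix
  have hproj := S.proj_of_mem (hmem p x)
  have h0 := (hc p x).2.2 (U.map (F.evalAt p x)) (V.map (F.evalAt p x)) (hcomm hU) (hcomm hV)
    (by rw [hproj]; exact hcomm hUV)
  -- The `δ'` coefficient is paired with `U ⊗ ∂_x V`; since `proj U = U`, the Casimir tensor gives
  -- `Tr(U ∂_x V)`.
  have h1 := congrArg (fun m => (m * (U.map (F.evalAt p x) ⊗ₖ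
    (V.map F.dxDerivation).map (F.evalAt p x))).trace) (hc p x).2.1
  simp only [smul_mul_assoc, Matrix.trace_smul, trace_casimirSwap_mul_kronecker, hproj] at h1
  rw [← Matrix.sum_mul_sum_eq_trace_kronecker] at h0 h1
  have h2 : F.evalAt p x (U * V.map F.dxDerivation).trace =
      (U.map (F.evalAt p x) * (V.map F.dxDerivation).map (F.evalAt p x)).trace := by
    simp only [Matrix.trace, Matrix.diag, Matrix.mul_apply, map_sum, map_mul, Matrix.map_apply]
  rw [map_add, map_smul, h2, ← h1]
  simp only [map_sum, map_mul]
  refine (congrArg₂ (· + ·) h0 rfl).trans (zero_add _)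

end LaxData

end

theorem mainTheorem1 {M : Type*} (F : FieldTheory M) (t : ClassicalType) (S : RSSystem F t.alg)
    (z₀ : OnePoint ℂ) (hcyc : S.NonCyclotomic z₀)
    (J : Matrix t.Idx t.Idx F.obs) (hreg : S.IsRegularZero z₀ J)
    (hdec : ∀ i j, F.Decreases (J i j))
    (n m : ℕ) (hn : n ∈ t.degrees) (hm : m ∈ t.degrees) :
    F.HasCharge (t.density J n) ∧ F.HasCharge (t.density J m) ∧
      (∀ p, Integrable (F.chargeBracketDensity (t.density J n) (t.density J m) p)
        F.space.measure) ∧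
      ∀ p, F.chargeBracket (t.density J n) (t.density J m) p = 0 := by
  have hJ : ∀ i j, J i j ∈ F.decreasing := hdec
  have hn2 := ClassicalType.two_le_of_mem_degrees hn
  have hm2 := ClassicalType.two_le_of_mem_degrees hm
  obtain ⟨c, hc⟩ := (RSSystem.IsRegularZero.isCurrent hreg hcyc).exists_br_coeff_zero
  have hbr := hc (fun D => ClassicalType.derivation_density D t J hn)
    (fun D => ClassicalType.derivation_density D t J hm) (t.commute_gradient J n)
    (t.commute_gradient J m) (t.commute_gradient_gradient J n m)
    (fun p x => t.gradient_map_mem_alg J (F.evalAt p x) (hreg.map_evalAt_mem p x) hn)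
  have hint := ClassicalType.gradient_integrability F.dxDerivation t J hn hm
  set U := t.gradient J n with hU
  set V := t.gradient J m with hV
  have hprod : F.dxDerivation (U * V).trace =
      (V * U.map F.dxDerivation).trace + (U * V.map F.dxDerivation).trace := by
    rw [← Derivation.trace_matrix_map, Derivation.matrix_map_mul, Matrix.trace_add,
      Matrix.trace_mul_comm (U.map _)]
  have hmem : (U * V).trace ∈ F.decreasing := sum_mem fun i _ => by
    rw [Matrix.diag, Matrix.mul_apply]
    exact sum_mem fun j _ => mul_mem (t.gradient_apply_mem hJ hn i j)
      (t.gradient_apply_mem hJ hm j i)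
  -- Both degrees are at least `2`, so the coefficient `n + m - 2` can be divided by.
  have hne : ((n - 1 : ℕ) : ℂ) + ((m - 1 : ℕ) : ℂ) ≠ 0 := by
    exact_mod_cast (by omega : (n - 1) + (m - 1) ≠ 0)
  have htr : (U * V.map F.dxDerivation).trace =
      (((m - 1 : ℕ) : ℂ) / (((n - 1 : ℕ) : ℂ) + ((m - 1 : ℕ) : ℂ))) •
        F.dxDerivation (U * V).trace := by
    have h : (((n - 1 : ℕ) : ℂ) + ((m - 1 : ℕ) : ℂ)) • (U * V.map F.dxDerivation).trace =
        ((m - 1 : ℕ) : ℂ) • F.dxDerivation (U * V).trace := by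
      rw [hprod, add_smul, hint, smul_add]
    rw [div_eq_inv_mul, mul_smul, ← h, smul_smul, inv_mul_cancel₀ hne, one_smul]
  -- The primitive is a multiple of `Tr(UV)`. It decreases at infinity because the entries of both
  -- gradients lie in the non-unital algebra of decreasing observables.
  obtain ⟨h, hh, hdx⟩ : ∃ h ∈ F.decreasing, (F.br (t.density J n) (t.density J m)).coeff 0 =
      F.dx h := by
    refine ⟨(c * (((m - 1 : ℕ) : ℂ) / (((n - 1 : ℕ) : ℂ) + ((m - 1 : ℕ) : ℂ)))) • (U * V).trace,
      SMulMemClass.smul_mem _ hmem, ?_⟩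
    rw [hbr, htr, smul_smul, ← FieldTheory.dxDerivation_apply, Derivation.map_smul]
  refine ⟨(F.mem_decreasing.1 (t.density_mem hJ hn)).hasCharge,
    (F.mem_decreasing.1 (t.density_mem hJ hm)).hasCharge, fun p => ?_, fun p => ?_⟩
  · rw [FieldTheory.chargeBracketDensity_eq, hdx]
    exact (F.mem_decreasing.1 hh).integrable_dx p
  · rw [FieldTheory.chargeBracket, FieldTheory.chargeBracketDensity_eq, hdx]
    exact (F.mem_decreasing.1 hh).integral_dx p
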